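/- **Setting.** Let $\langle\cdot,\cdot\rangle$ be the metric of signature $(4,2)$ on $\mathbb R^{4,2}$. Null lines represent oriented $2$-spheres, null $2$-planes represent contact elements. Fix $\mathfrak p,\mathfrak q$ with $\langle\mathfrak p,\mathfrak p\rangle=-1$, $\langle\mathfrak q,\mathfrak q\rangle=1$, $\langle\mathfrak p,\mathfrak q\rangle=0$. Null lines in $\mathfrak p^\perp$ are point spheres (points); those in $\mathfrak p^\perp\cap\mathfrak q^\perp$ are the points of a $2$-sphere, with orientations $\mathfrak l^\pm=\mathfrak q\mp\mathfrak p$. This sphere bounds the hyperbolic quadric $\mathcal Q=\{\mathfrak n:\langle\mathfrak n,\mathfrak n\rangle=0,\langle\mathfrak n,\mathfrak q\rangle=-1,\langle\mathfrak n,\mathfrak p\rangle=0\}$ (two copies of hyperbolic space), whose oriented planes are $\mathcal H=\{\mathfrak n:\langle\mathfrak n,\mathfrak n\rangle=0,\langle\mathfrak n,\mathfrak q\rangle=0,\langle\mathfrak n,\mathfrak p\rangle=-1\}$. Let $\mathcal V\subseteq\mathbb Z^2$ be a connected domain with its lattice edges and elementary quadrilaterals $(ijkl)$. * A *discrete Legendre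 map* $f$ assigns to each vertex a contact element $f_i$ such that adjacent contact elements meet in exactly one sphere (a curvature sphere) and, for every $\mathfrak p'$ with $\langle\mathfrak p',\mathfrak p'\rangle=-1$, the four point spheres $f\cap\mathfrak p'^\perp$ of each quadrilateral span an at most $3$-dimensional space (circular net). It is *totally umbilic* if all curvature spheres coincide. * A sphere congruence $s$ is *isothermic* if adjacent, and opposite, spheres of a quadrilateral are not in oriented contact, the four spheres of each quadrilateral span a $3$-dimensional space, and their cross-ratios are $a_{ij}/a_{jk}$ for a nowhere zero function $a$ on edges that agrees on opposite edges. A pair $(s^+,s^-)$ is a *Darboux pair* if both are isothermic with a common $a$ and there are homogeneous coordinates $\mathfrak s^\pm$ that are *Königs dual*: $\mathfrak s^+_i-\mathfrak s^+_j\parallel\mathfrak s^-_i-\mathfrak s^-_j$ on edges, and $\mathfrak s^+_i-\mathfrak s^+_k\parallel\mathfrak s^-_j-\mathfrak s^-_l$, $\mathfrak s^+_j-\mathfrak s^+_l\parallel\mathfrak s^-_i-\mathfrak s^-_k$ on quadrilaterals. It is *non-isotropic* if $\langle\mathfrak s^+_i,\mathfrak s^-_i\rangle\neq0$ for all $i$.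 * A *discrete flat front* is a discrete Legendre map $f$ such that each $f_i$ contains elements of $\mathcal Q$ and of $\mathcal H$ (that is, $f$ projects to the hyperbolic quadric), and $f=s^+\oplus s^-$ for a Darboux pair $(s^+,s^-)$ with $s^\pm\perp\mathfrak l^\pm$. The *hyperbolic Gauss maps* $h^\pm$ of $f$ are the point spheres of the contact elements $(f\cap\mathfrak l^{\pm\perp})+\langle\mathfrak l^\pm\rangle$. * A *circle* is a $(2,1)$-plane $\gamma\subset\mathfrak p^\perp$. A discrete Legendre map $f$ is *orthogonal* to a circle congruence $\gamma$ if the point sphere of $f_i$ lies in $\gamma_i$ and all $\mathfrak s\in f_i$ satisfy $\langle\mathfrak s,\mathfrak c+\langle\mathfrak c,\mathfrak p\rangle\mathfrak p\rangle=0$ for all null $\mathfrak c\perp\gamma_i$. A *flat connection* for $\gamma$ consists of Lie inversions $\sigma_{ij}=\sigma_{ji}:\mathfrak r\mapsto\mathfrak r-\frac{2\langle\mathfrak r,\mathfrak a_{ij}\rangle}{\langle\mathfrak a_{ij},\mathfrak a_{ij}\rangle}\mathfrak a_{ij}$, one for each edge, with $\langle\mathfrak a_{ij},\mathfrak a_{ij}\rangle\ne0$,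 $\mathfrak a_{ij}\perp\mathfrak p$, $\sigma_{ij}(\gamma_j)=\gamma_i$, and $\sigma_{ij}\sigma_{jk}=\sigma_{il}\sigma_{lk}$ on quadrilaterals. **Theorem.** (1) The hyperbolic Gauss maps $h^\pm$ of a discrete flat front form a non-isotropic Darboux pair with values in the points of the sphere $\mathfrak q$, and the Legendre maps $h^\pm\oplus\langle\mathfrak l^\pm\rangle$ are totally umbilic. (2) Conversely, let $(h^+,h^-)$ be a non-isotropic Darboux pair with values in the points of the sphere $\mathfrak q$. The planes $\gamma_i=h^+_i+h^-_i+\langle\mathfrak q\rangle$ of the circles through $h^+_i$ and $h^-_i$ that meet this sphere orthogonally form a circle congruence, which is cyclic: it has a flat connection of Lie inversions as above with $\sigma_{ij}(h^\pm_j)=h^\pm_i$. For any such connection $\sigma$, let $f$ be an orthogonal net of the resulting cyclic system, that is, a discrete Legendre map orthogonal to $\gamma$ with $\sigma_{ij}(f_j)=f_i$ on edges, which does not have all its point spheres on the sphere $\mathfrak q$. Then $f$ projects to a discrete flat front in the hyperbolic quadric bounded by the sphere $\mathfrak q$. -/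

import Mathlib

namespace LieGeom

/-! ### Lie sphere geometry in `ℝ^{4,2}` -/

/-- The vector space underlying `ℝ^{4,2}`. -/
abbrev R42 : Type := Fin 6 → ℝ

/-- The metric of signature `(4,2)`. -/
noncomputable def lie : LinearMap.BilinForm ℝ R42 :=
  Matrix.toBilin' (Matrix.diagonal ![1, 1, 1, 1, -1, -1])

theorem lie_apply (x y : R42) :
    lie x y = x 0 * y 0 + x 1 * y 1 + x 2 * y 2 + x 3 * y 3 - x 4 * y 4 - x 5 * y 5 := by
  simp [lie, Matrix.toBilin'_apply', Matrix.mulVec_diagonal, dotProduct, Fin.sum_univ_succ]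
  ring

theorem lie_comm (x y : R42) : lie x y = lie y x := by
  rw [lie_apply, lie_apply]; ring

/-- The hyperplane of all vectors orthogonal to `x`. Its null lines form the linear sphere
complex of `x`. -/
noncomputable def perp (x : R42) : Submodule ℝ R42 := LinearMap.ker (lie x)

theorem mem_perp (x y : R42) : y ∈ perp x ↔ lie x y = 0 := Iff.rfl

/-- Contact elements: null planes of `ℝ^{4,2}`, that is, lines in the Lie quadric. -/
def IsContactElement (Z : Submodule ℝ R42) : Prop :=
  Module.finrank ℝ Z = 2 ∧ ∀ x ∈ Z, ∀ y ∈ Z, lie x y = 0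

/-- The point sphere of a contact element, for the point sphere complex `p`. -/
noncomputable def pointSphere (p : R42) (Z : Submodule ℝ R42) : Submodule ℝ R42 := Z ⊓ perp p

/-- The Lie inversion in the linear sphere complex of `a` (used for `⟨a,a⟩ ≠ 0`). -/
noncomputable def lieInversion (a : R42) : R42 →ₗ[ℝ] R42 :=
  LinearMap.id - (2 / lie a a) • (lie a).smulRight a

theorem lieInversion_apply (a x : R42) :
    lieInversion a x = x - (2 * lie x a / lie a a) • a := by
  rw [lie_comm x a]
  simp only [lieInversion, LinearMap.sub_apply, LinearMap.id_apply, LinearMap.smul_apply,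
    LinearMap.smulRight_apply, smul_smul]
  congr 2
  ring

/-- Two vectors are parallel if they are linearly dependent. -/
def Parallel (x y : R42) : Prop := ∃ α β : ℝ, (α ≠ 0 ∨ β ≠ 0) ∧ α • x + β • y = 0

/-- The cross-ratio of four concircular spheres, that is, of four null lines in a nondegenerate
3-plane, in terms of arbitrary homogeneous coordinate vectors. -/
noncomputable def crossRatio (x₁ x₂ x₃ x₄ : R42) : ℝ :=
  (lie x₂ x₃ * lie x₄ x₁ + lie x₁ x₂ * lie x₃ x₄ - lie x₁ x₃ * lie x₂ x₄) /
    (2 * (lie x₂ x₃ * lie x₄ x₁))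

/-- In a rational parametrization `t ↦ a + t b + t² c` of a conic of null lines, `crossRatio` is
the usual cross-ratio of the four parameters. -/
theorem crossRatio_conic (a b c : R42) (haa : lie a a = 0) (hcc : lie c c = 0)
    (hab : lie a b = 0) (hbc : lie b c = 0) (hbb : lie b b = -2 * lie a c) (hac : lie a c ≠ 0)
    (t₁ t₂ t₃ t₄ : ℝ) (h23 : t₂ ≠ t₃) (h41 : t₄ ≠ t₁) :
    crossRatio (a + t₁ • b + t₁ ^ 2 • c) (a + t₂ • b + t₂ ^ 2 • c)
        (a + t₃ • b + t₃ ^ 2 • c) (a + t₄ • b + t₄ ^ 2 • c) =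
      ((t₁ - t₂) * (t₃ - t₄)) / ((t₂ - t₃) * (t₄ - t₁)) := by
  have key : ∀ s t : ℝ, lie (a + s • b + s ^ 2 • c) (a + t • b + t ^ 2 • c) =
      lie a c * (s - t) ^ 2 := by
    intro s t
    simp only [map_add, map_smul, LinearMap.add_apply, LinearMap.smul_apply, smul_eq_mul,
      haa, hcc, hab, hbc, hbb, lie_comm b a, lie_comm c a, lie_comm c b]
    ring
  have h1 : t₂ - t₃ ≠ 0 := sub_ne_zero.mpr h23
  have h2 : t₄ - t₁ ≠ 0 := sub_ne_zero.mpr h41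
  simp only [crossRatio, key]
  field_simp
  ring

/-! ### The hyperbolic quadric -/

/-- The quadric of constant curvature given by the point sphere complex `p` and the space form
vector `q`. -/
def quadric (p q : R42) : Set R42 := {n | lie n n = 0 ∧ lie n q = -1 ∧ lie n p = 0}

/-- Its complex of (oriented) hyperplanes. -/
def hyperplanes (p q : R42) : Set R42 := {n | lie n n = 0 ∧ lie n q = 0 ∧ lie n p = -1}

/-! ### Nets on a quadrilateral domain `V ⊆ ℤ²` -/

/-- The edges of a domain in the square lattice. -/
def latticeGraph (V : Set (ℤ × ℤ)) : SimpleGraph V where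
  Adj i j :=
    (j.1 = i.1 + (1, 0) ∨ j.1 = i.1 + (0, 1)) ∨ (i.1 = j.1 + (1, 0) ∨ i.1 = j.1 + (0, 1))
  symm := ⟨fun _ _ h => h.symm⟩
  loopless := ⟨fun i h => by
    rcases h with (h | h) | (h | h) <;> simp [Prod.ext_iff] at h⟩

/-- `(i,j,k,l)` is an elementary quadrilateral of the domain. -/
def IsFace {V : Set (ℤ × ℤ)} (i j k l : V) : Prop :=
  j.1 = i.1 + (1, 0) ∧ k.1 = i.1 + (1, 1) ∧ l.1 = i.1 + (0, 1)

variable {V : Set (ℤ × ℤ)}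

/-- `x` consists of homogeneous coordinate vectors of the sphere congruence `s`. -/
def IsLift (s : V → Submodule ℝ R42) (x : V → R42) : Prop :=
  ∀ i, x i ≠ 0 ∧ lie (x i) (x i) = 0 ∧ s i = Submodule.span ℝ {x i}

/-- Circular nets of point spheres: the four point spheres of each elementary quadrilateral are
concircular. -/
def IsCircularNet (s : V → Submodule ℝ R42) : Prop :=
  ∀ i j k l : V, IsFace i j k l →
    Module.finrank ℝ ((s i ⊔ s j ⊔ s k ⊔ s l : Submodule ℝ R42)) ≤ 3

/-- Discrete Legendre maps: adjacent contact elements intersect in a (curvature) sphere, and the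
point sphere map is a circular net for any point sphere complex. -/
def IsLegendre (f : V → Submodule ℝ R42) : Prop :=
  (∀ i, IsContactElement (f i)) ∧
  (∀ i j, (latticeGraph V).Adj i j → Module.finrank ℝ ((f i ⊓ f j : Submodule ℝ R42)) = 1) ∧
  (∀ p : R42, lie p p = -1 → IsCircularNet (fun i => pointSphere p (f i)))

/-- A discrete Legendre map is totally umbilic if all its curvature spheres coincide. -/
def IsTotallyUmbilic (u : V → Submodule ℝ R42) : Prop :=
  IsLegendre u ∧ ∃ n : R42, n ≠ 0 ∧ lie n n = 0 ∧
    ∀ i j, (latticeGraph V).Adj i j → u i ⊓ u j = Submodule.span ℝ {n}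

/-- Real functions on (unoriented) edges that take the same, nonzero, value on opposite edges of
each quadrilateral. -/
def IsEdgeLabelling (a : V → V → ℝ) : Prop :=
  (∀ i j, (latticeGraph V).Adj i j → a i j = a j i ∧ a i j ≠ 0) ∧
  (∀ i j k l : V, IsFace i j k l → a i j = a k l ∧ a j k = a l i)

/-- Discrete isothermic sphere congruences with edge labelling `a`: nets in the Lie quadric with
planar, nondegenerate faces, whose face cross-ratios factorize. (Four pairwise non-orthogonal null
vectors that span a 3-plane span a `(2,1)`- or a `(1,2)`-plane.) -/
def IsIsothermic (s : V → Submodule ℝ R42) (a : V → V → ℝ) : Prop :=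
  ∃ x : V → R42, IsLift s x ∧
    (∀ i j, (latticeGraph V).Adj i j → lie (x i) (x j) ≠ 0) ∧
    (∀ i j k l : V, IsFace i j k l →
      lie (x i) (x k) ≠ 0 ∧ lie (x j) (x l) ≠ 0 ∧
      Module.finrank ℝ (Submodule.span ℝ {x i, x j, x k, x l}) = 3 ∧
      crossRatio (x i) (x j) (x k) (x l) = a i j / a j k)

/-- Königs dual maps: corresponding edges are parallel, and opposite diagonals of corresponding
faces are parallel. -/
def IsKoenigsDual (x y : V → R42) : Prop :=
  (∀ i j, (latticeGraph V).Adj i j → Parallel (x i - x j) (y i - y j)) ∧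
  (∀ i j k l : V, IsFace i j k l →
    Parallel (x i - x k) (y j - y l) ∧ Parallel (x j - x l) (y i - y k))

/-- Darboux pairs: pairs of isothermic sphere congruences (with the same labelling) that admit
Königs dual lifts. -/
def IsDarbouxPair (s t : V → Submodule ℝ R42) : Prop :=
  (∃ a : V → V → ℝ, IsEdgeLabelling a ∧ IsIsothermic s a ∧ IsIsothermic t a) ∧
  ∃ x y : V → R42, IsLift s x ∧ IsLift t y ∧ IsKoenigsDual x y

/-- A Darboux pair is non-isotropic if corresponding spheres are never in oriented contact. -/
def NonIsotropic (s t : V → Submodule ℝ R42) : Prop :=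
  ∀ i, ∃ x ∈ s i, ∃ y ∈ t i, lie x y ≠ 0

/-- `f` has a space form projection `(F, T)` into the quadric of `p` and `q`: `F` is its point
sphere map and `T` its tangent plane congruence. -/
def HasProjection (p q : R42) (f : V → Submodule ℝ R42) : Prop :=
  ∃ F T : V → R42, ∀ i, F i ∈ f i ∧ F i ∈ quadric p q ∧ T i ∈ f i ∧ T i ∈ hyperplanes p q

/-- Discrete flat fronts in the hyperbolic quadric of `p` and `q`: discrete Legendre maps that
project to this quadric and are spanned by an (isotropic) Darboux pair of isothermic sphere
congruences, each lying in one of the parabolic linear sphere complexes of `q ∓ p`. -/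
def IsFlatFront (p q : R42) (f : V → Submodule ℝ R42) : Prop :=
  IsLegendre f ∧ HasProjection p q f ∧
  ∃ s t : V → Submodule ℝ R42, IsDarbouxPair s t ∧
    (∀ i, f i = s i ⊔ t i) ∧ (∀ i, s i ≤ perp (q - p)) ∧ (∀ i, t i ≤ perp (q + p))

/-- The hyperbolic Gauss map of `f` on the oriented infinity sphere `l`, where `l = q - p` or
`l = q + p`: the sphere of `f i` in oriented contact with `l` touches `l` in this point. -/
noncomputable def gaussMap (p l : R42) (f : V → Submodule ℝ R42) : V → Submodule ℝ R42 :=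
  fun i => pointSphere p ((f i ⊓ perp l) ⊔ Submodule.span ℝ {l})

/-! ### Circle congruences -/

/-- Circles: `(2,1)`-planes orthogonal to the point sphere complex `p`. -/
def IsCircle (p : R42) (γ : Submodule ℝ R42) : Prop :=
  γ ≤ perp p ∧ ∃ e₁ e₂ e₃ : R42,
    lie e₁ e₁ = 1 ∧ lie e₂ e₂ = 1 ∧ lie e₃ e₃ = -1 ∧
    lie e₁ e₂ = 0 ∧ lie e₁ e₃ = 0 ∧ lie e₂ e₃ = 0 ∧ γ = Submodule.span ℝ {e₁, e₂, e₃}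

/-- The plane of the circle through the points `x` and `y` that meets the sphere `r`
orthogonally. -/
noncomputable def orthCircle (p : R42) (x y : Submodule ℝ R42) (r : R42) : Submodule ℝ R42 :=
  x ⊔ y ⊔ Submodule.span ℝ {r + lie r p • p}

/-- The discrete Legendre map `f` is orthogonal to the circle congruence `γ`: its point spheres lie
on the circles, and all spheres in `f i` meet the spheres `c` containing the circle
orthogonally. -/
def IsOrthogonalNet (p : R42) (γ f : V → Submodule ℝ R42) : Prop :=
  IsLegendre f ∧ (∀ i, pointSphere p (f i) ≤ γ i) ∧
  ∀ i, ∀ s ∈ f i, ∀ c : R42, (∀ x ∈ γ i, lie c x = 0) → lie c c = 0 →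
    lie s (c + lie c p • p) = 0

/-- The Lie inversions in the complexes `a i j`, `(i,j)` an edge, map adjacent spaces `u j`, `u i`
onto each other. -/
def Interchanges (a : V → V → R42) (u : V → Submodule ℝ R42) : Prop :=
  ∀ i j, (latticeGraph V).Adj i j → (u j).map (lieInversion (a i j)) = u i

/-- A flat connection for the circle congruence `γ`, comprised of M-Lie inversions that map
adjacent circles onto each other. -/
def IsFlatConnection (p : R42) (γ : V → Submodule ℝ R42) (a : V → V → R42) : Prop :=
  (∀ i j, (latticeGraph V).Adj i j →
    lie (a i j) (a i j) ≠ 0 ∧ lie (a i j) p = 0 ∧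
    lieInversion (a i j) = lieInversion (a j i)) ∧
  Interchanges a γ ∧
  ∀ i j k l : V, IsFace i j k l →
    lieInversion (a i j) ∘ₗ lieInversion (a j k) = lieInversion (a i l) ∘ₗ lieInversion (a l k)

end LieGeom

/-!
Let `W = ⟨p, q⟩^⊥`, a Lorentzian 4-space whose null lines are the points of the sphere `q`.

**Gauss maps.** A contact element that projects to the quadric is spanned by a point `F` and a
tangent plane `T`, and its spheres in the parabolic complexes of `q - p` and `q + p` are `F + T` and
`F - T`. The hyperbolic Gauss maps are the images of these spheres under the orthogonal projection
onto `W` (`gaussMap_eq_span`). This projection is linear, so it preserves the Königs relations and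
the linear relations on faces, and it is isometric on each of the two parabolic complexes, so it
preserves cross-ratios. This gives the first part, `IsFlatFront.gaussMaps`. The Gauss map of
`q + p` is treated by replacing `p` with `-p`. Joining an isothermic net in `W` with a fixed null
vector orthogonal to `W` gives a totally umbilic Legendre map
(`isTotallyUmbilic_of_isothermic`).

**Connections.** For three pairwise non-orthogonal null vectors `x, y, z`, the inversions in
`x - y`, `y - z`, `x - w`, `w - z` satisfy the closing condition of a flat connection if and only if
the null vector `w = a x + b y + c z` (not orthogonal to `x` and `z`) satisfies `a + b + c = 1`, that
is, lies in the affine plane of `x, y, z` (`lieInversion_comp_of_affine`,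
`affine_of_lieInversion_comp`). Königs dual lifts have affine faces (`affine_of_koenigsDual`), so
their edges define a flat connection (`exists_flatConnection`).

**Orthogonal nets.** Any connection of the cyclic system fixes `p` and `q`
(`lie_connection_eq_zero`), hence if one point sphere does not lie on the sphere `q`, none does. The
contact elements of an orthogonal net are then spanned by `F = X + Y - q` and `T = ±(X - Y) + p`,
where `X`, `Y` are lifts of the Darboux pair with `⟨X, Y⟩ = -1/2`
(`IsContactElement.exists_normal_form`). The connection transports `X`, `Y` and the sign. By flatness
the faces of `X` and `Y` are affine, hence the vectors `2 X - (q ∓ p)` and `2 Y - (q ± p)`, which span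
the contact elements, are isothermic with the same cross-ratios as the Darboux pair. Their edges and
diagonals are those of `2 X` and `2 Y`, so it remains to see that `X` and `Y` are Königs dual. Their
edges are parallel because both are parallel to the vectors that define the inversions. The given
Königs dual lifts are rescalings of `X` and `Y`, and parallelity of edges forces the scaling to be
constant along each edge on which the two maps are not interchanged (`scale_eq_of_parallel`). This settles the
diagonals unless the maps are interchanged along two opposite edges of a face, where affinity of the
face supplies the claim (`IsNormalizedPair.isKoenigsDual`).
-/

namespace LieGeom

/-! ### Consequences of the signature -/

theorem lie_self_nonneg {z : R42} (h4 : z 4 = 0) (h5 : z 5 = 0) : 0 ≤ lie z z := by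
  rw [lie_apply, h4, h5]
  nlinarith [mul_self_nonneg (z 0), mul_self_nonneg (z 1), mul_self_nonneg (z 2),
    mul_self_nonneg (z 3)]

theorem eq_zero_of_lie_self {z : R42} (h4 : z 4 = 0) (h5 : z 5 = 0) (h : lie z z = 0) :
    z = 0 := by
  rw [lie_apply, h4, h5] at h
  have h0 := mul_self_nonneg (z 0)
  have h1 := mul_self_nonneg (z 1)
  have h2 := mul_self_nonneg (z 2)
  have h3 := mul_self_nonneg (z 3)
  have e0 : z 0 = 0 := mul_self_eq_zero.mp (by linarith)
  have e1 : z 1 = 0 := mul_self_eq_zero.mp (by linarith)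
  have e2 : z 2 = 0 := mul_self_eq_zero.mp (by linarith)
  have e3 : z 3 = 0 := mul_self_eq_zero.mp (by linarith)
  funext m
  fin_cases m
  · exact e0
  · exact e1
  · exact e2
  · exact e3
  · exact h4
  · exact h5

/-- The negative part of `ℝ^{4,2}` is two-dimensional, hence three vectors always have a nontrivial
combination in the positive part. -/
theorem exists_combination_pos (u v w : R42) :
    ∃ α β γ : ℝ, (α ≠ 0 ∨ β ≠ 0 ∨ γ ≠ 0) ∧
      (α • u + β • v + γ • w) 4 = 0 ∧ (α • u + β • v + γ • w) 5 = 0 := by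
  obtain ⟨c, hc, h⟩ := Matrix.exists_mulVec_eq_zero_iff
    (M := !![u 4, v 4, w 4; u 5, v 5, w 5; 0, 0, 0]) |>.mpr (by simp [Matrix.det_fin_three])
  refine ⟨c 0, c 1, c 2, ?_, ?_, ?_⟩
  · by_contra! hh
    apply hc
    funext m
    fin_cases m
    · exact hh.1
    · exact hh.2.1
    · exact hh.2.2
  · have := congrFun h 0
    simp [Matrix.mulVec, dotProduct, Fin.sum_univ_succ] at this
    simp only [Pi.add_apply, Pi.smul_apply, smul_eq_mul]
    linarith
  · have := congrFun h 1
    simp [Matrix.mulVec, dotProduct, Fin.sum_univ_succ] at this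
    simp only [Pi.add_apply, Pi.smul_apply, smul_eq_mul]
    linarith

/-- The orthogonal complement of a timelike vector is Lorentzian: orthogonal null vectors in it are
parallel. -/
theorem parallel_of_null {p x y : R42} (hp : lie p p < 0) (hxx : lie x x = 0)
    (hyy : lie y y = 0) (hxy : lie x y = 0) (hpx : lie p x = 0) (hpy : lie p y = 0) :
    Parallel x y := by
  obtain ⟨α, β, γ, hne, h4, h5⟩ := exists_combination_pos x y p
  have hlie : lie (α • x + β • y + γ • p) (α • x + β • y + γ • p) = γ ^ 2 * lie p p := by
    simp only [map_add, map_smul, LinearMap.add_apply, LinearMap.smul_apply, smul_eq_mul,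
      hxx, hyy, hxy, hpx, hpy, lie_comm y x, lie_comm x p, lie_comm y p]
    ring
  have h0 := lie_self_nonneg h4 h5
  have hγ : γ = 0 := by
    by_contra hγ
    have : 0 < γ ^ 2 := by positivity
    nlinarith
  subst hγ
  have hz := eq_zero_of_lie_self h4 h5 (by rw [hlie]; ring)
  refine ⟨α, β, ?_, ?_⟩
  · simpa using hne
  · simpa using hz

/-- The orthogonal complement of a negative definite plane is positive definite. -/
theorem lie_self_of_perp_negative_plane {p n v : R42} (hp : lie p p = -1) (hn : lie n n = -1)
    (hpn : lie p n = 0) (hpv : lie p v = 0) (hnv : lie n v = 0) :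
    0 ≤ lie v v ∧ (lie v v = 0 → v = 0) := by
  obtain ⟨α, β, γ, hne, h4, h5⟩ := exists_combination_pos p n v
  have hlie : lie (α • p + β • n + γ • v) (α • p + β • n + γ • v) =
      γ ^ 2 * lie v v - α ^ 2 - β ^ 2 := by
    simp only [map_add, map_smul, LinearMap.add_apply, LinearMap.smul_apply, smul_eq_mul,
      hp, hn, hpn, hpv, hnv, lie_comm n p, lie_comm v p, lie_comm v n]
    ring
  have h0 := lie_self_nonneg h4 h5
  rw [hlie] at h0
  have hγ : γ ≠ 0 := by
    rintro rfl
    have hα : α = 0 := by nlinarith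
    have hβ : β = 0 := by nlinarith
    simp [hα, hβ] at hne
  have hγ2 : 0 < γ ^ 2 := by positivity
  refine ⟨?_, fun hv => ?_⟩
  · by_contra! h
    nlinarith
  · have hα : α = 0 := by nlinarith
    have hβ : β = 0 := by nlinarith
    have hz := eq_zero_of_lie_self h4 h5 (by rw [hlie, hv, hα, hβ]; ring)
    simpa [hα, hβ, hγ] using hz

/-! ### Linear algebra of null vectors -/

theorem eq_smul_of_parallel {x y : R42} (hx : x ≠ 0) (h : Parallel x y) : ∃ c : ℝ, y = c • x := by
  obtain ⟨α, β, hne, h⟩ := h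
  have hβ : β ≠ 0 := by
    rintro rfl
    simp_all
  refine ⟨-α / β, ?_⟩
  have : β • y = (-α) • x := by
    rw [neg_smul]; exact eq_neg_of_add_eq_zero_right h
  rw [div_eq_inv_mul, mul_smul, ← this, smul_smul, inv_mul_cancel₀ hβ, one_smul]

theorem Parallel.map {x y : R42} (φ : R42 →ₗ[ℝ] R42) (h : Parallel x y) :
    Parallel (φ x) (φ y) := by
  obtain ⟨α, β, hne, h⟩ := h
  exact ⟨α, β, hne, by rw [← map_smul, ← map_smul, ← map_add, h, map_zero]⟩

theorem Parallel.symm {x y : R42} (h : Parallel x y) : Parallel y x := by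
  obtain ⟨α, β, hne, h⟩ := h
  exact ⟨β, α, hne.symm, by rw [add_comm, h]⟩

theorem parallel_smul_smul (v : R42) (s t : ℝ) : Parallel (s • v) (t • v) := by
  by_cases hs : s = 0
  · exact ⟨1, 0, Or.inl one_ne_zero, by simp [hs]⟩
  · exact ⟨t, -s, Or.inr (neg_ne_zero.mpr hs), by module⟩

theorem Parallel.smul {x y : R42} (h : Parallel x y) (s t : ℝ) :
    Parallel (s • x) (t • y) := by
  obtain ⟨α, β, hne, h⟩ := h
  by_cases hs : s = 0
  · exact ⟨1, 0, Or.inl one_ne_zero, by simp [hs]⟩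
  by_cases ht : t = 0
  · exact ⟨0, 1, Or.inr one_ne_zero, by simp [ht]⟩
  refine ⟨α / s, β / t, ?_, ?_⟩
  · exact hne.imp (fun h => div_ne_zero h hs) (fun h => div_ne_zero h ht)
  · rw [smul_smul, smul_smul, div_mul_cancel₀ _ hs, div_mul_cancel₀ _ ht, h]

theorem lie_sub_self {x y : R42} (hx : lie x x = 0) (hy : lie y y = 0) :
    lie (x - y) (x - y) = -2 * lie x y := by
  simp only [map_sub, LinearMap.sub_apply, hx, hy, lie_comm y x]
  ring

/-- Three null vectors without orthogonal pairs are linearly independent. -/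
theorem coeff_eq_zero_of_null {x y z : R42} (hx : lie x x = 0) (hy : lie y y = 0)
    (hz : lie z z = 0) (hxy : lie x y ≠ 0) (hyz : lie y z ≠ 0) (hxz : lie x z ≠ 0) {α β γ : ℝ}
    (h : α • x + β • y + γ • z = 0) : α = 0 ∧ β = 0 ∧ γ = 0 := by
  have h1 := congrArg (lie x) h
  have h2 := congrArg (lie y) h
  have h3 := congrArg (lie z) h
  simp only [map_add, map_smul, smul_eq_mul, hx, hy, hz, lie_comm y x, lie_comm z x, lie_comm z y,
    map_zero] at h1 h2 h3
  have hα : α * (2 * (lie x y * lie x z)) = 0 := by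
    linear_combination (-lie y z) * h1 + lie x z * h2 + lie x y * h3
  have hα : α = 0 := by simpa [hxy, hxz] using hα
  subst hα
  have hβ : β = 0 := by simpa [hyz] using h3
  have hγ : γ = 0 := by simpa [hyz] using h2
  exact ⟨rfl, hβ, hγ⟩

theorem finrank_span_null_quadruple_iff {x y z w : R42} (hx : lie x x = 0) (hy : lie y y = 0)
    (hz : lie z z = 0) (hxy : lie x y ≠ 0) (hyz : lie y z ≠ 0) (hxz : lie x z ≠ 0) :
    Module.finrank ℝ (Submodule.span ℝ {x, y, z, w}) = 3 ↔
      ∃ a b c : ℝ, w = a • x + b • y + c • z := by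
  have hli : LinearIndependent ℝ ![x, y, z] := by
    rw [Fintype.linearIndependent_iff]
    intro g hg
    simp only [Fin.sum_univ_three, Matrix.cons_val_zero, Matrix.cons_val_one,
      Matrix.cons_val_two, Matrix.head_cons, Matrix.tail_cons] at hg
    obtain ⟨h0, h1, h2⟩ := coeff_eq_zero_of_null hx hy hz hxy hyz hxz hg
    intro m
    fin_cases m <;> assumption
  have h3 : Module.finrank ℝ (Submodule.span ℝ {x, y, z}) = 3 := by
    have := finrank_span_eq_card hli
    have hr : Set.range ![x, y, z] = {x, y, z} := by
      ext v
      simp only [Matrix.range_cons, Matrix.range_empty, Set.mem_union, Set.mem_singleton_iff,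
        Set.mem_insert_iff, Set.mem_empty_iff_false, or_false]
    rw [hr] at this
    simpa using this
  have hle : Submodule.span ℝ {x, y, z} ≤ Submodule.span ℝ {x, y, z, w} :=
    Submodule.span_mono (by
      intro v hv
      simp only [Set.mem_insert_iff, Set.mem_singleton_iff] at hv ⊢
      tauto)
  constructor
  · intro h
    have heq := Submodule.eq_of_le_of_finrank_eq hle (h3.trans h.symm)
    have hw : w ∈ Submodule.span ℝ {x, y, z} := by
      rw [heq]; exact Submodule.subset_span (by simp)
    obtain ⟨a, b, c, h⟩ := Submodule.mem_span_triple.mp hw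
    exact ⟨a, b, c, h.symm⟩
  · rintro ⟨a, b, c, h⟩
    have hw : w ∈ Submodule.span ℝ {x, y, z} :=
      Submodule.mem_span_triple.mpr ⟨a, b, c, h.symm⟩
    have heq : Submodule.span ℝ {x, y, z} = Submodule.span ℝ {x, y, z, w} := by
      refine le_antisymm hle (Submodule.span_le.mpr ?_)
      intro v hv
      simp only [Set.mem_insert_iff, Set.mem_singleton_iff] at hv
      rcases hv with rfl | rfl | rfl | rfl
      · exact Submodule.subset_span (by simp)
      · exact Submodule.subset_span (by simp)
      · exact Submodule.subset_span (by simp)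
      · exact hw
    rw [← heq, h3]

/-! ### Isothermic nets in terms of homogeneous coordinates -/

variable {V : Set (ℤ × ℤ)}

theorem IsFace.adj {i j k l : V} (h : IsFace i j k l) :
    (latticeGraph V).Adj i j ∧ (latticeGraph V).Adj j k ∧ (latticeGraph V).Adj k l ∧
      (latticeGraph V).Adj l i := by
  obtain ⟨hj, hk, hl⟩ := h
  refine ⟨Or.inl (Or.inl hj), Or.inl (Or.inr ?_), Or.inr (Or.inl ?_), Or.inr (Or.inr hl)⟩
  · rw [hj, hk, add_assoc]; rfl
  · rw [hk, hl, add_assoc]; rfl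

/-- `IsIsothermic` for given homogeneous coordinate vectors, with the dimension of the face spans
expressed by a linear relation. -/
def IsIsothermicLift (x : V → R42) (a : V → V → ℝ) : Prop :=
  (∀ i j, (latticeGraph V).Adj i j → lie (x i) (x j) ≠ 0) ∧
    ∀ i j k l : V, IsFace i j k l → lie (x i) (x k) ≠ 0 ∧ lie (x j) (x l) ≠ 0 ∧
      (∃ α β γ : ℝ, x l = α • x i + β • x j + γ • x k) ∧
      crossRatio (x i) (x j) (x k) (x l) = a i j / a j k

/-- Being isothermic only depends on the inner products up to a rescaling of the vectors, and on
the existence of linear relations on the faces. -/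
theorem IsIsothermicLift.transfer {x x' : V → R42} {a : V → V → ℝ} (h : IsIsothermicLift x a)
    (κ : V → ℝ) (hκ : ∀ i, κ i ≠ 0)
    (hlie : ∀ i j, lie (x' i) (x' j) = κ i * κ j * lie (x i) (x j))
    (hrel : ∀ i j k l : V, IsFace i j k l →
      (∃ α β γ : ℝ, x l = α • x i + β • x j + γ • x k) →
        ∃ α β γ : ℝ, x' l = α • x' i + β • x' j + γ • x' k) :
    IsIsothermicLift x' a := by
  refine ⟨fun i j hij => ?_, fun i j k l hf => ?_⟩
  · rw [hlie]
    exact mul_ne_zero (mul_ne_zero (hκ i) (hκ j)) (h.1 i j hij)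
  · obtain ⟨h1, h2, h3, h4⟩ := h.2 i j k l hf
    refine ⟨?_, ?_, hrel i j k l hf h3, ?_⟩
    · rw [hlie]
      exact mul_ne_zero (mul_ne_zero (hκ i) (hκ k)) h1
    · rw [hlie]
      exact mul_ne_zero (mul_ne_zero (hκ j) (hκ l)) h2
    · rw [← h4]
      simp only [crossRatio, hlie]
      have hne : κ i * κ j * κ k * κ l ≠ 0 :=
        mul_ne_zero (mul_ne_zero (mul_ne_zero (hκ i) (hκ j)) (hκ k)) (hκ l)
      rw [← mul_div_mul_left _ (2 * (lie (x j) (x k) * lie (x l) (x i))) hne]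
      congr 1 <;> ring

theorem IsLift.exists_smul {s : V → Submodule ℝ R42} {x x' : V → R42} (hx : IsLift s x)
    (hx' : IsLift s x') : ∃ κ : V → ℝ, ∀ i, κ i ≠ 0 ∧ x' i = κ i • x i := by
  have : ∀ i, ∃ κ : ℝ, κ ≠ 0 ∧ x' i = κ • x i := by
    intro i
    have hmem : x' i ∈ Submodule.span ℝ {x i} := by
      rw [← (hx i).2.2, (hx' i).2.2]
      exact Submodule.mem_span_singleton_self _
    obtain ⟨κ, hκ⟩ := Submodule.mem_span_singleton.mp hmem
    refine ⟨κ, ?_, hκ.symm⟩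
    rintro rfl
    exact (hx' i).1 (by rw [← hκ, zero_smul])
  choose κ hκ using this
  exact ⟨κ, hκ⟩

theorem isIsothermic_iff {s : V → Submodule ℝ R42} {x : V → R42} {a : V → V → ℝ}
    (hx : IsLift s x) : IsIsothermic s a ↔ IsIsothermicLift x a := by
  constructor
  · rintro ⟨z, hz, h1, h2⟩
    have hzi : IsIsothermicLift z a := by
      refine ⟨h1, fun i j k l hf => ?_⟩
      obtain ⟨hik, hjl, h3, h4⟩ := h2 i j k l hf
      obtain ⟨hij, hjk, -, -⟩ := hf.adj
      exact ⟨hik, hjl, (finrank_span_null_quadruple_iff (hz i).2.1 (hz j).2.1 (hz k).2.1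
        (h1 i j hij) (h1 j k hjk) hik).mp h3, h4⟩
    obtain ⟨κ, hκ⟩ := hz.exists_smul hx
    refine hzi.transfer κ (fun i => (hκ i).1) (fun i j => ?_) ?_
    · rw [(hκ i).2, (hκ j).2]
      simp only [map_smul, LinearMap.smul_apply, smul_eq_mul]
      ring
    · rintro i j k l - ⟨α, β, γ, h⟩
      refine ⟨κ l * α / κ i, κ l * β / κ j, κ l * γ / κ k, ?_⟩
      rw [(hκ i).2, (hκ j).2, (hκ k).2, (hκ l).2, h]
      simp only [smul_smul, smul_add, div_mul_cancel₀ _ (hκ _).1]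
  · rintro ⟨h1, h2⟩
    refine ⟨x, hx, h1, fun i j k l hf => ?_⟩
    obtain ⟨hik, hjl, h3, h4⟩ := h2 i j k l hf
    obtain ⟨hij, hjk, -, -⟩ := hf.adj
    exact ⟨hik, hjl, (finrank_span_null_quadruple_iff (hx i).2.1 (hx j).2.1 (hx k).2.1
      (h1 i j hij) (h1 j k hjk) hik).mpr h3, h4⟩

/-! ### Totally umbilic Legendre maps -/

theorem finrank_span_pair {x y : R42} (h : ∀ a b : ℝ, a • x + b • y = 0 → a = 0 ∧ b = 0) :
    Module.finrank ℝ (Submodule.span ℝ {x, y}) = 2 := by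
  have hli : LinearIndependent ℝ ![x, y] := LinearIndependent.pair_iff.mpr h
  have := finrank_span_eq_card hli
  have hr : Set.range ![x, y] = {x, y} := by
    ext v
    simp only [Matrix.range_cons, Matrix.range_empty, Set.mem_union, Set.mem_singleton_iff,
      Set.mem_insert_iff, Set.mem_empty_iff_false, or_false]
  rw [hr] at this
  simpa using this

theorem finrank_span_triple_le (x y z : R42) :
    Module.finrank ℝ (Submodule.span ℝ {x, y, z}) ≤ 3 := by
  classical
  have h := finrank_span_finset_le_card (R := ℝ) ({x, y, z} : Finset R42)
  simp only [Finset.coe_insert, Finset.coe_singleton] at h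
  exact h.trans Finset.card_le_three

theorem mem_span_sup_span {x y v : R42} :
    v ∈ Submodule.span ℝ {x} ⊔ Submodule.span ℝ {y} ↔ ∃ a b : ℝ, a • x + b • y = v := by
  rw [← Submodule.span_insert, Submodule.mem_span_pair]

/-- Joining the points of an isothermic net with a null vector `l` orthogonal to all of them yields
a totally umbilic Legendre map, with `l` as its only curvature sphere. -/
theorem isTotallyUmbilic_of_isothermic {h : V → Submodule ℝ R42} {a : V → V → ℝ} {x : V → R42}
    {l r : R42} (hx : IsLift h x) (hiso : IsIsothermicLift x a) (hl : lie l l = 0)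
    (hlr : lie l r ≠ 0) (hxr : ∀ i, lie (x i) r = 0) (hxl : ∀ i, lie (x i) l = 0) :
    IsTotallyUmbilic (fun i => h i ⊔ Submodule.span ℝ {l}) := by
  have hl0 : l ≠ 0 := by
    rintro rfl
    simp at hlr
  have hmem : ∀ i v, v ∈ h i ⊔ Submodule.span ℝ {l} ↔ ∃ a b : ℝ, a • x i + b • l = v := by
    intro i v
    rw [(hx i).2.2, mem_span_sup_span]
  have hind : ∀ i (a b : ℝ), a • x i + b • l = 0 → a = 0 ∧ b = 0 := by
    intro i a b hab
    have h1 := congrArg (fun v => lie v r) hab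
    simp only [map_add, map_smul, LinearMap.add_apply, LinearMap.smul_apply, smul_eq_mul, hxr,
      mul_zero, zero_add, map_zero, LinearMap.zero_apply] at h1
    have hb : b = 0 := by simpa [hlr] using h1
    subst hb
    have : a = 0 := by simpa [(hx i).1] using hab
    exact ⟨this, rfl⟩
  have hcurv : ∀ i j, (latticeGraph V).Adj i j →
      (h i ⊔ Submodule.span ℝ {l}) ⊓ (h j ⊔ Submodule.span ℝ {l}) = Submodule.span ℝ {l} := by
    intro i j hij
    refine le_antisymm ?_ (le_inf le_sup_right le_sup_right)
    rintro v ⟨hvi, hvj⟩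
    obtain ⟨a, b, rfl⟩ := (hmem i v).mp hvi
    obtain ⟨c, d, hcd⟩ := (hmem j _).mp hvj
    have h1 := congrArg (lie (x i)) hcd
    simp only [map_add, map_smul, smul_eq_mul, hxl, (hx i).2.1, mul_zero, add_zero] at h1
    have hc : c = 0 := by simpa [hiso.1 i j hij] using h1
    rw [← hcd, hc, zero_smul, zero_add]
    exact Submodule.mem_span_singleton.mpr ⟨d, rfl⟩
  refine ⟨⟨fun i => ⟨?_, ?_⟩, fun i j hij => ?_, fun p hp i j k m hf => ?_⟩, l, hl0, hl, hcurv⟩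
  · beta_reduce
    rw [(hx i).2.2, ← Submodule.span_insert]
    exact finrank_span_pair (hind i)
  · intro v hv w hw
    obtain ⟨a, b, rfl⟩ := (hmem i v).mp hv
    obtain ⟨c, d, rfl⟩ := (hmem i w).mp hw
    simp only [map_add, map_smul, LinearMap.add_apply, LinearMap.smul_apply, smul_eq_mul,
      (hx i).2.1, hl, hxl, lie_comm l (x i)]
    ring
  · change Module.finrank ℝ
      (((h i ⊔ Submodule.span ℝ {l}) ⊓ (h j ⊔ Submodule.span ℝ {l}) : Submodule ℝ R42)) = 1
    rw [hcurv i j hij]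
    exact finrank_span_singleton hl0
  · by_cases hpl : lie p l = 0
    · -- If `l` lies in the complex of `p`, it is the point sphere of all the contact elements.
      have hle : ∀ i, pointSphere p (h i ⊔ Submodule.span ℝ {l}) ≤ Submodule.span ℝ {l} := by
        rintro i v ⟨hv, hpv⟩
        obtain ⟨a, b, rfl⟩ := (hmem i v).mp hv
        rw [SetLike.mem_coe, mem_perp] at hpv
        simp only [map_add, map_smul, smul_eq_mul, hpl, mul_zero, add_zero] at hpv
        rcases mul_eq_zero.mp hpv with ha | hpx
        · rw [ha, zero_smul, zero_add]
          exact Submodule.mem_span_singleton.mpr ⟨b, rfl⟩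
        · obtain ⟨α, β, hne, hαβ⟩ :=
            parallel_of_null (by rw [hp]; norm_num) (hx i).2.1 hl (hxl i) hpx hpl
          have := hind i α β hαβ
          tauto
      refine le_trans (Submodule.finrank_mono (t := Submodule.span ℝ {l}) ?_) ?_
      · exact sup_le (sup_le (sup_le (hle i) (hle j)) (hle k)) (hle m)
      · rw [finrank_span_singleton hl0]
        norm_num
    · -- Otherwise the point spheres arise by projection along `l`.
      set w : V → R42 := fun i => x i - (lie p (x i) / lie p l) • l with hw
      have hle : ∀ i, pointSphere p (h i ⊔ Submodule.span ℝ {l}) ≤ Submodule.span ℝ {w i} := by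
        rintro i v ⟨hv, hpv⟩
        obtain ⟨a, b, rfl⟩ := (hmem i v).mp hv
        rw [SetLike.mem_coe, mem_perp] at hpv
        simp only [map_add, map_smul, smul_eq_mul] at hpv
        refine Submodule.mem_span_singleton.mpr ⟨a, ?_⟩
        have hb : b = -(a * (lie p (x i) / lie p l)) := by
          field_simp
          linarith
        rw [hw, hb]
        module
      obtain ⟨-, -, ⟨α, β, γ, hrel⟩, -⟩ := hiso.2 i j k m hf
      have hwm : w m = α • w i + β • w j + γ • w k := by
        simp only [hw, hrel, map_add, map_smul, smul_eq_mul]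
        module
      refine le_trans (Submodule.finrank_mono (t := Submodule.span ℝ {w i, w j, w k}) ?_)
        (finrank_span_triple_le _ _ _)
      have hsub : ∀ v ∈ ({w i, w j, w k} : Set R42),
          Submodule.span ℝ {v} ≤ Submodule.span ℝ {w i, w j, w k} := by
        intro v hv
        exact Submodule.span_mono (Set.singleton_subset_iff.mpr hv)
      refine sup_le (sup_le (sup_le ((hle i).trans (hsub _ (by simp)))
        ((hle j).trans (hsub _ (by simp)))) ((hle k).trans (hsub _ (by simp)))) ((hle m).trans ?_)
      rw [Submodule.span_singleton_le_iff_mem]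
      exact Submodule.mem_span_triple.mpr ⟨α, β, γ, hwm.symm⟩

/-! ### The hyperbolic Gauss maps of a flat front -/

/-- The orthogonal projection onto `⟨p, q⟩^⊥`, when `⟨p,p⟩ = -1`, `⟨q,q⟩ = 1` and `⟨p,q⟩ = 0`. -/
noncomputable def sphereProj (p q : R42) : R42 →ₗ[ℝ] R42 :=
  LinearMap.id - (lie q).smulRight q + (lie p).smulRight p

theorem sphereProj_apply (p q v : R42) : sphereProj p q v = v - lie q v • q + lie p v • p := rfl

theorem lie_left_sphereProj {p q : R42} (hp : lie p p = -1) (hpq : lie p q = 0) (v : R42) :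
    lie p (sphereProj p q v) = 0 := by
  simp only [sphereProj_apply, map_add, map_sub, map_smul, smul_eq_mul, hp, hpq]
  ring

theorem lie_right_sphereProj {p q : R42} (hq : lie q q = 1) (hpq : lie p q = 0) (v : R42) :
    lie q (sphereProj p q v) = 0 := by
  simp only [sphereProj_apply, map_add, map_sub, map_smul, smul_eq_mul, hq, hpq, lie_comm q p]
  ring

theorem lie_sphereProj_sphereProj {p q : R42} (hp : lie p p = -1) (hq : lie q q = 1)
    (hpq : lie p q = 0) (v w : R42) :
    lie (sphereProj p q v) (sphereProj p q w) =
      lie v w - lie q v * lie q w + lie p v * lie p w := by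
  simp only [sphereProj_apply, map_add, map_sub, map_smul, smul_eq_mul, hq, hpq, hp, lie_comm q p,
    lie_comm v p, lie_comm v q, LinearMap.add_apply, LinearMap.sub_apply, LinearMap.smul_apply]
  ring

/-- The projection is isometric on the parabolic complex of `q - p`. -/
theorem lie_sphereProj_of_perp {p q : R42} (hp : lie p p = -1) (hq : lie q q = 1)
    (hpq : lie p q = 0) {v w : R42} (hv : lie (q - p) v = 0) (hw : lie (q - p) w = 0) :
    lie (sphereProj p q v) (sphereProj p q w) = lie v w := by
  rw [lie_sphereProj_sphereProj hp hq hpq]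
  simp only [map_sub, LinearMap.sub_apply] at hv hw
  rw [sub_eq_zero.mp hv, sub_eq_zero.mp hw]
  ring

theorem IsContactElement.eq_combination {p q : R42} {f : Submodule ℝ R42} {F T v : R42}
    (hf : IsContactElement f) (hF : F ∈ f) (hFQ : F ∈ quadric p q) (hT : T ∈ f)
    (hTH : T ∈ hyperplanes p q) (hv : v ∈ f) : v = (-lie q v) • F + (-lie p v) • T := by
  obtain ⟨-, hFq, hFp⟩ := hFQ
  obtain ⟨-, hTq, hTp⟩ := hTH
  rw [lie_comm] at hFq hFp hTq hTp
  have hspan : Submodule.span ℝ {F, T} = f := by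
    refine Submodule.eq_of_le_of_finrank_eq (Submodule.span_le.mpr ?_) ?_
    · rintro w (rfl | rfl)
      · exact hF
      · exact hT
    · rw [hf.1]
      refine finrank_span_pair fun a b hab => ?_
      have h1 := congrArg (lie q) hab
      have h2 := congrArg (lie p) hab
      simp only [map_add, map_smul, smul_eq_mul, map_zero, hFq, hFp, hTq, hTp] at h1 h2
      exact ⟨by linarith, by linarith⟩
  rw [← hspan] at hv
  obtain ⟨a, b, rfl⟩ := Submodule.mem_span_pair.mp hv
  simp only [map_add, map_smul, smul_eq_mul, hFq, hFp, hTq, hTp]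
  module

/-- The spheres of a contact element in the parabolic complexes of `q - p` and `q + p` project to
points that are not in contact. -/
theorem lie_sphereProj_ne_zero {p q : R42} (hp : lie p p = -1) (hq : lie q q = 1)
    (hpq : lie p q = 0) {f : Submodule ℝ R42} {F T x y : R42}
    (hf : IsContactElement f) (hF : F ∈ f) (hFQ : F ∈ quadric p q) (hT : T ∈ f)
    (hTH : T ∈ hyperplanes p q) (hx : x ∈ f) (hy : y ∈ f) (hx0 : x ≠ 0) (hy0 : y ≠ 0)
    (hlx : lie (q - p) x = 0) (hly : lie (q + p) y = 0) :
    lie (sphereProj p q x) (sphereProj p q y) ≠ 0 := by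
  rw [lie_sphereProj_sphereProj hp hq hpq, hf.2 x hx y hy]
  simp only [map_sub, map_add, LinearMap.sub_apply, LinearMap.add_apply] at hlx hly
  have hxq : lie p x = lie q x := by linarith
  have hyq : lie p y = -lie q y := by linarith
  have h1 := hf.eq_combination hF hFQ hT hTH hx
  have h2 := hf.eq_combination hF hFQ hT hTH hy
  rw [hxq] at h1
  rw [hyq] at h2
  have hqx : lie q x ≠ 0 := by
    intro h
    rw [h] at h1
    simp at h1
    exact hx0 h1
  have hqy : lie q y ≠ 0 := by
    intro h
    rw [h] at h2
    simp at h2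
    exact hy0 h2
  rw [hxq, hyq]
  have := mul_ne_zero hqx hqy
  intro h
  apply this
  linarith

theorem gaussMap_eq_span {p q : R42} (hp : lie p p = -1) (hq : lie q q = 1)
    (hpq : lie p q = 0) {f : V → Submodule ℝ R42} {i : V} {F T x : R42}
    (hf : IsContactElement (f i)) (hF : F ∈ f i) (hFQ : F ∈ quadric p q) (hT : T ∈ f i)
    (hTH : T ∈ hyperplanes p q) (hx : x ∈ f i) (hx0 : x ≠ 0) (hlx : lie (q - p) x = 0) :
    gaussMap p (q - p) f i = Submodule.span ℝ {sphereProj p q x} := by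
  have hcomb : ∀ u ∈ f i, lie (q - p) u = 0 → u = (-lie q u) • (F + T) := by
    intro u hu hlu
    simp only [map_sub, LinearMap.sub_apply] at hlu
    have h := hf.eq_combination hF hFQ hT hTH hu
    rw [← sub_eq_zero.mp hlu, ← smul_add] at h
    exact h
  have hqx : lie q x ≠ 0 := by
    intro h
    apply hx0
    rw [hcomb x hx hlx, h, neg_zero, zero_smul]
  have hpx : lie p x = lie q x := by
    simp only [map_sub, LinearMap.sub_apply] at hlx
    linarith
  have hproj : sphereProj p q (q - p) = 0 := by
    simp only [sphereProj_apply, map_sub, hp, hq, hpq, lie_comm q p]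
    module
  apply le_antisymm
  · rintro v ⟨hv, hpv⟩
    obtain ⟨u, ⟨hu, hlu⟩, w, hw, rfl⟩ := Submodule.mem_sup.mp hv
    obtain ⟨b, rfl⟩ := Submodule.mem_span_singleton.mp hw
    rw [SetLike.mem_coe, mem_perp] at hlu hpv
    have hux : u = (lie q u / lie q x) • x := by
      conv_lhs => rw [hcomb u hu hlu]
      conv_rhs => rw [hcomb x hx hlx]
      rw [smul_smul]
      congr 1
      simp only [map_smul, smul_eq_mul]
      have hFT : lie q (F + T) = -1 := by
        rw [map_add, lie_comm q F, lie_comm q T, hFQ.2.1, hTH.2.1]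
        norm_num
      rw [hFT]
      field_simp
    have hqv : lie q (u + b • (q - p)) = 0 := by
      simp only [map_add, map_sub, map_smul, smul_eq_mul, LinearMap.sub_apply, hp, hq, hpq,
        lie_comm q p] at hlu hpv ⊢
      linarith
    have hfix : u + b • (q - p) = sphereProj p q (u + b • (q - p)) := by
      conv_rhs => rw [sphereProj_apply, hqv, hpv, zero_smul, zero_smul, sub_zero, add_zero]
    rw [hfix, map_add, map_smul, hproj, smul_zero, add_zero, hux, map_smul]
    exact Submodule.smul_mem _ _ (Submodule.mem_span_singleton_self _)
  · rw [Submodule.span_singleton_le_iff_mem]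
    refine ⟨?_, lie_left_sphereProj hp hpq x⟩
    have : sphereProj p q x = x + (-lie q x) • (q - p) := by
      rw [sphereProj_apply, hpx]
      module
    rw [this]
    refine Submodule.add_mem_sup ⟨hx, hlx⟩ (Submodule.smul_mem _ _ ?_)
    exact Submodule.mem_span_singleton_self _

/-- The projections of homogeneous coordinate vectors `x i` of spheres of `f i` in the parabolic
complex of `q - p` are lifts of the hyperbolic Gauss map. As the projection is linear and isometric
on this complex, the Gauss map inherits the isothermic property. -/
theorem gaussMap_properties {p q : R42} (hp : lie p p = -1) (hq : lie q q = 1)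
    (hpq : lie p q = 0) {f s : V → Submodule ℝ R42} {F T x : V → R42} {a : V → V → ℝ}
    (hf : ∀ i, IsContactElement (f i))
    (hFT : ∀ i, F i ∈ f i ∧ F i ∈ quadric p q ∧ T i ∈ f i ∧ T i ∈ hyperplanes p q)
    (hx : IsLift s x) (hxf : ∀ i, x i ∈ f i) (hlx : ∀ i, lie (q - p) (x i) = 0)
    (hx0 : ∀ i, sphereProj p q (x i) ≠ 0) (hs : IsIsothermic s a) :
    IsLift (gaussMap p (q - p) f) (fun i => sphereProj p q (x i)) ∧
      IsIsothermic (gaussMap p (q - p) f) a ∧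
      IsTotallyUmbilic (fun i => gaussMap p (q - p) f i ⊔ Submodule.span ℝ {q - p}) := by
  have hlift : IsLift (gaussMap p (q - p) f) (fun i => sphereProj p q (x i)) := by
    refine fun i => ⟨hx0 i, ?_, ?_⟩
    · rw [lie_sphereProj_of_perp hp hq hpq (hlx i) (hlx i), (hx i).2.1]
    · obtain ⟨hF, hFQ, hT, hTH⟩ := hFT i
      exact gaussMap_eq_span hp hq hpq (hf i) hF hFQ hT hTH (hxf i) (hx i).1 (hlx i)
  have hiso : IsIsothermicLift (fun i => sphereProj p q (x i)) a := by
    refine ((isIsothermic_iff hx).mp hs).transfer (fun _ => 1) (fun _ => one_ne_zero) ?_ ?_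
    · intro i j
      rw [lie_sphereProj_of_perp hp hq hpq (hlx i) (hlx j), one_mul, one_mul]
    · rintro i j k l - ⟨α, β, γ, h⟩
      exact ⟨α, β, γ, by simp only [h, map_add, map_smul]⟩
  refine ⟨hlift, (isIsothermic_iff hlift).mpr hiso,
    isTotallyUmbilic_of_isothermic (r := q) hlift hiso ?_ ?_ ?_ ?_⟩
  · simp only [map_sub, LinearMap.sub_apply, hp, hq, hpq, lie_comm q p]
    norm_num
  · simp only [map_sub, LinearMap.sub_apply, hq, hpq]
    norm_num
  · exact fun i => by rw [lie_comm, lie_right_sphereProj hq hpq]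
  · exact fun i => by
      rw [lie_comm, map_sub, LinearMap.sub_apply, lie_right_sphereProj hq hpq,
        lie_left_sphereProj hp hpq, sub_zero]

theorem IsFlatFront.gaussMaps {p q : R42} (hp : lie p p = -1) (hq : lie q q = 1)
    (hpq : lie p q = 0) {f : V → Submodule ℝ R42} (h : IsFlatFront p q f) :
    IsDarbouxPair (gaussMap p (q - p) f) (gaussMap p (q + p) f) ∧
      NonIsotropic (gaussMap p (q - p) f) (gaussMap p (q + p) f) ∧
      (∀ i, gaussMap p (q - p) f i ≤ perp p ⊓ perp q) ∧
      (∀ i, gaussMap p (q + p) f i ≤ perp p ⊓ perp q) ∧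
      IsTotallyUmbilic (fun i => gaussMap p (q - p) f i ⊔ Submodule.span ℝ {q - p}) ∧
      IsTotallyUmbilic (fun i => gaussMap p (q + p) f i ⊔ Submodule.span ℝ {q + p}) := by
  obtain ⟨hleg, ⟨F, T, hFT⟩, s, t, ⟨⟨a, hlab, hs, ht⟩, x, y, hx, hy, hK⟩, hst, hsl, htl⟩ := h
  have hf := hleg.1
  have hxs : ∀ i, x i ∈ s i := fun i => by
    rw [(hx i).2.2]; exact Submodule.mem_span_singleton_self _
  have hyt : ∀ i, y i ∈ t i := fun i => by
    rw [(hy i).2.2]; exact Submodule.mem_span_singleton_self _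
  have hxf : ∀ i, x i ∈ f i := fun i => by rw [hst i]; exact Submodule.mem_sup_left (hxs i)
  have hyf : ∀ i, y i ∈ f i := fun i => by rw [hst i]; exact Submodule.mem_sup_right (hyt i)
  have hlx : ∀ i, lie (q - p) (x i) = 0 := fun i => hsl i (hxs i)
  have hly : ∀ i, lie (q + p) (y i) = 0 := fun i => htl i (hyt i)
  have hne : ∀ i, lie (sphereProj p q (x i)) (sphereProj p q (y i)) ≠ 0 := fun i => by
    obtain ⟨hF, hFQ, hT, hTH⟩ := hFT i
    exact lie_sphereProj_ne_zero hp hq hpq (hf i) hF hFQ hT hTH (hxf i) (hyf i) (hx i).1 (hy i).1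
      (hlx i) (hly i)
  have hx0 : ∀ i, sphereProj p q (x i) ≠ 0 := fun i h => hne i (by rw [h]; simp)
  have hy0 : ∀ i, sphereProj p q (y i) ≠ 0 := fun i h => hne i (by rw [h]; simp)
  obtain ⟨hxlift, hxiso, hxumb⟩ := gaussMap_properties hp hq hpq hf hFT hx hxf hlx hx0 hs
  -- The second Gauss map is the first one for the opposite point sphere complex `-p`.
  have hneg : sphereProj (-p) q = sphereProj p q := by
    refine LinearMap.ext fun v => ?_
    simp [sphereProj_apply]
  have hgneg : gaussMap (-p) (q - -p) f = gaussMap p (q + p) f := by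
    funext i
    have : perp (-p) = perp p := by
      ext v
      simp [mem_perp]
    simp [gaussMap, pointSphere, this, sub_neg_eq_add]
  obtain ⟨hylift, hyiso, hyumb⟩ := gaussMap_properties (p := -p) (F := F) (T := fun i => -T i)
    (by simpa using hp) hq (by simpa using hpq) hf
    (fun i => by simpa [quadric, hyperplanes, neg_eq_iff_eq_neg] using hFT i) hy hyf
    (by simpa using hly) (by simpa [hneg] using hy0) ht
  rw [hgneg, hneg] at hylift
  rw [hgneg] at hyiso hyumb
  rw [sub_neg_eq_add] at hyumb
  refine ⟨⟨⟨a, hlab, hxiso, hyiso⟩, _, _, hxlift, hylift, ?_, ?_⟩, fun i => ?_, fun i => ?_,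
    fun i => ?_, hxumb, hyumb⟩
  · intro i j hij
    simpa using (hK.1 i j hij).map (sphereProj p q)
  · intro i j k l hf
    obtain ⟨h1, h2⟩ := hK.2 i j k l hf
    exact ⟨by simpa using h1.map (sphereProj p q), by simpa using h2.map (sphereProj p q)⟩
  · refine ⟨_, ?_, _, ?_, hne i⟩
    · rw [(hxlift i).2.2]
      exact Submodule.mem_span_singleton_self _
    · rw [(hylift i).2.2]
      exact Submodule.mem_span_singleton_self _
  · rw [(hxlift i).2.2, Submodule.span_singleton_le_iff_mem]
    exact ⟨lie_left_sphereProj hp hpq _, lie_right_sphereProj hq hpq _⟩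
  · rw [(hylift i).2.2, Submodule.span_singleton_le_iff_mem]
    exact ⟨lie_left_sphereProj hp hpq _, lie_right_sphereProj hq hpq _⟩

/-! ### Lie inversions -/

theorem lie_lieInversion {a : R42} (ha : lie a a ≠ 0) (x y : R42) :
    lie (lieInversion a x) (lieInversion a y) = lie x y := by
  simp only [lieInversion_apply, map_sub, map_smul, LinearMap.sub_apply, LinearMap.smul_apply,
    smul_eq_mul, lie_comm a y]
  field_simp
  ring

theorem lieInversion_lieInversion {a : R42} (ha : lie a a ≠ 0) (x : R42) :
    lieInversion a (lieInversion a x) = x := by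
  have h : lie (lieInversion a x) a = -lie x a := by
    rw [lieInversion_apply]
    simp only [map_sub, map_smul, LinearMap.sub_apply, LinearMap.smul_apply, smul_eq_mul]
    field_simp
    ring
  rw [lieInversion_apply a (lieInversion a x), h, lieInversion_apply]
  module

theorem lieInversion_of_perp {a x : R42} (h : lie x a = 0) : lieInversion a x = x := by
  rw [lieInversion_apply, h]
  simp

theorem lieInversion_smul {t : ℝ} (ht : t ≠ 0) (a : R42) :
    lieInversion (t • a) = lieInversion a := by
  refine LinearMap.ext fun x => ?_
  simp only [lieInversion_apply, map_smul, LinearMap.smul_apply, smul_eq_mul, smul_smul]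
  congr 2
  by_cases ha : lie a a = 0
  · simp [ha]
  · field_simp

theorem lieInversion_neg (a : R42) : lieInversion (-a) = lieInversion a := by
  rw [← neg_one_smul ℝ a, lieInversion_smul (by norm_num)]

theorem lieInversion_sub_apply {x y : R42} (hx : lie x x = 0) (hy : lie y y = 0) (z : R42) :
    lieInversion (x - y) z = z + (lie z (x - y) / lie x y) • (x - y) := by
  rw [lieInversion_apply, lie_sub_self hx hy, sub_eq_add_neg, ← neg_smul]
  congr 2
  by_cases h : lie x y = 0
  · simp [h]
  · field_simp

/-- The inversion in the difference of two null vectors interchanges them. -/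
theorem lieInversion_sub_right {x y : R42} (hx : lie x x = 0) (hy : lie y y = 0)
    (hxy : lie x y ≠ 0) : lieInversion (x - y) y = x := by
  rw [lieInversion_sub_apply hx hy, map_sub, hy, lie_comm y x, sub_zero, div_self hxy]
  module

theorem lieInversion_sub_left {x y : R42} (hx : lie x x = 0) (hy : lie y y = 0)
    (hxy : lie x y ≠ 0) : lieInversion (x - y) x = y := by
  rw [← neg_sub, lieInversion_neg, lieInversion_sub_right hy hx (by rwa [lie_comm])]

theorem exists_smul_of_lieInversion {a x y : R42} (h : lieInversion a y = x) :
    ∃ t : ℝ, x - y = t • a :=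
  ⟨-(2 * lie y a / lie a a), by rw [← h, lieInversion_apply]; module⟩

theorem sub_ne_zero_of_lie {x y : R42} (hx : lie x x = 0) (hxy : lie x y ≠ 0) : x - y ≠ 0 := by
  intro h
  rw [← sub_eq_zero.mp h] at hxy
  exact hxy hx

/-- An inversion is determined by one pair of distinct corresponding null vectors. -/
theorem lieInversion_eq_of_apply {a x y : R42} (hx : lie x x = 0)
    (hxy : lie x y ≠ 0) (h : lieInversion a y = x) : lieInversion a = lieInversion (x - y) := by
  obtain ⟨t, ht⟩ := exists_smul_of_lieInversion h
  rw [ht, lieInversion_smul]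
  rintro rfl
  exact sub_ne_zero_of_lie hx hxy (by rw [ht, zero_smul])

/-! ### Flatness and affine coplanarity -/

/-- Four homogeneous coordinate vectors in an affine plane give rise to a quadrilateral of
inversions that closes. -/
theorem lieInversion_comp_of_affine {x y z w : R42} {a b c : ℝ} (hx : lie x x = 0)
    (hy : lie y y = 0) (hz : lie z z = 0) (hw : lie w w = 0) (hxy : lie x y ≠ 0)
    (hyz : lie y z ≠ 0) (hxw : lie x w ≠ 0) (hwz : lie w z ≠ 0)
    (h : w = a • x + b • y + c • z) (habc : a + b + c = 1) :
    lieInversion (x - y) ∘ₗ lieInversion (y - z) =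
      lieInversion (x - w) ∘ₗ lieInversion (w - z) := by
  obtain rfl : c = 1 - a - b := by linarith
  have hU : lie x w = b * lie x y + (1 - a - b) * lie x z := by
    rw [h]
    simp only [map_add, map_smul, smul_eq_mul, hx]
    ring
  have hW : lie w z = a * lie x z + b * lie y z := by
    rw [h]
    simp only [map_add, map_smul, smul_eq_mul, LinearMap.add_apply, LinearMap.smul_apply, hz]
    ring
  -- The condition that `w` is null.
  have hP : a * b * lie x y + a * (1 - a - b) * lie x z + b * (1 - a - b) * lie y z = 0 := by
    have h2 : lie w w =
        2 * (a * b * lie x y + a * (1 - a - b) * lie x z + b * (1 - a - b) * lie y z) := by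
      rw [h]
      simp only [map_add, map_smul, smul_eq_mul, LinearMap.add_apply, LinearMap.smul_apply, hx, hy,
        hz, lie_comm y x, lie_comm z x, lie_comm z y]
      ring
    linarith
  refine LinearMap.ext fun s => ?_
  have hS : lie s w = a * lie s x + b * lie s y + (1 - a - b) * lie s z := by
    rw [h]
    simp only [map_add, map_smul, smul_eq_mul]
  have hzw : w - z = a • (x - y) + (a + b) • (y - z) := by
    rw [h]; module
  have hxw' : x - w = (1 - a) • (x - y) + (1 - a - b) • (y - z) := by
    rw [h]; module
  have e1 : lie (y - z) (x - y) = lie x y + lie y z - lie x z := by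
    simp only [map_sub, LinearMap.sub_apply, hy, lie_comm y x, lie_comm z x, lie_comm z y]
    ring
  have e2 : lie (w - z) (x - w) = lie x w + lie w z - lie x z := by
    simp only [map_sub, LinearMap.sub_apply, hw, lie_comm w x, lie_comm z x, lie_comm z w]
    ring
  simp only [LinearMap.comp_apply]
  rw [lieInversion_sub_apply hy hz s, lieInversion_sub_apply hw hz s,
    lieInversion_sub_apply hx hy, lieInversion_sub_apply hx hw]
  simp only [map_add, map_smul, LinearMap.add_apply, LinearMap.smul_apply, smul_eq_mul, e1, e2,
    (map_sub (lie s) : ∀ v v' : R42, lie s (v - v') = lie s v - lie s v'), hS]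
  set u := lie x y
  set v := lie x z
  set t := lie y z
  set U := lie x w
  set W := lie w z
  set X := lie s x
  set Y := lie s y
  set Z := lie s z
  set S := a * X + b * Y + (1 - a - b) * Z with hSdef
  -- Comparison of the coefficients of `y - z` and `x - y`.
  have c2 : (Y - Z) / t = (a + b) * ((S - Z) / W) +
      (1 - a - b) * ((X - S + (S - Z) / W * (U + W - v)) / U) := by
    have : (Y - Z) / t - ((a + b) * ((S - Z) / W) +
        (1 - a - b) * ((X - S + (S - Z) / W * (U + W - v)) / U)) =
        (v * (Y - Z) - t * (X - Z)) *
          (a * b * u + a * (1 - a - b) * v + b * (1 - a - b) * t) / (t * U * W) := by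
      field_simp
      rw [hSdef, hU, hW]
      ring
    rw [hP, mul_zero, zero_div] at this
    linarith
  have c1 : (X - Y + (Y - Z) / t * (u + t - v)) / u = a * ((S - Z) / W) +
      (1 - a) * ((X - S + (S - Z) / W * (U + W - v)) / U) := by
    have : (X - Y + (Y - Z) / t * (u + t - v)) / u - (a * ((S - Z) / W) +
        (1 - a) * ((X - S + (S - Z) / W * (U + W - v)) / U)) =
        (u - v) * (v * (Y - Z) - t * (X - Z)) *
          (a * b * u + a * (1 - a - b) * v + b * (1 - a - b) * t) / (u * t * U * W) := by
      field_simp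
      rw [hSdef, hU, hW]
      ring
    rw [hP, mul_zero, zero_div] at this
    linarith
  rw [c1, c2, hzw, hxw']
  module

/-- Conversely, if the inversions close around a quadrilateral, then the four vectors lie in an
affine plane. -/
theorem affine_of_lieInversion_comp {x y z w : R42} {a b c : ℝ} (hx : lie x x = 0)
    (hy : lie y y = 0) (hz : lie z z = 0) (hw : lie w w = 0) (hxy : lie x y ≠ 0)
    (hyz : lie y z ≠ 0) (hxz : lie x z ≠ 0) (hxw : lie x w ≠ 0) (hwz : lie w z ≠ 0)
    (h : w = a • x + b • y + c • z)
    (hflat : lieInversion (x - y) ∘ₗ lieInversion (y - z) =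
      lieInversion (x - w) ∘ₗ lieInversion (w - z)) : a + b + c = 1 := by
  -- The left-hand side moves every vector within the directions of the plane of `x, y, z`.
  have hL : ∀ s, ∃ m n : ℝ,
      (lieInversion (x - y) ∘ₗ lieInversion (y - z)) s = s + m • (y - z) + n • (x - y) := by
    intro s
    rw [LinearMap.comp_apply, lieInversion_sub_apply hx hy, lieInversion_sub_apply hy hz s]
    exact ⟨_, _, rfl⟩
  obtain ⟨m, n, h1⟩ := hL w
  rw [hflat, LinearMap.comp_apply, lieInversion_sub_left hw hz hwz,
    lieInversion_sub_apply hx hw] at h1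
  obtain ⟨m', n', h2⟩ := hL (lieInversion (w - z) x)
  have hinv : lieInversion (w - z) (lieInversion (w - z) x) = x := by
    have hne : lie (w - z) (w - z) ≠ 0 := by
      rw [lie_sub_self hw hz]
      simpa using hwz
    exact lieInversion_lieInversion hne x
  rw [hflat, LinearMap.comp_apply, hinv, lieInversion_sub_left hx hw hxw,
    lieInversion_sub_apply hw hz] at h2
  set κ := lie z (x - w) / lie x w with hκ
  set κ' := lie x (w - z) / lie w z with hκ'
  obtain ⟨p1, p2, p3⟩ := coeff_eq_zero_of_null hx hy hz hxy hyz hxz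
    (α := (1 + κ) * a + n - κ) (β := (1 + κ) * b + m - n) (γ := (1 + κ) * c - m - 1) (by
      have : (w + m • (y - z) + n • (x - y)) - (z + κ • (x - w)) = 0 := by rw [h1, sub_self]
      rw [h] at this
      rw [← this]
      module)
  obtain ⟨q1, q2, q3⟩ := coeff_eq_zero_of_null hx hy hz hxy hyz hxz
    (α := (κ' - 1) * a + 1 + n') (β := (κ' - 1) * b + m' - n') (γ := (κ' - 1) * c - κ' - m') (by
      have : (x + κ' • (w - z) + m' • (y - z) + n' • (x - y)) - w = 0 := by rw [← h2, sub_self]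
      rw [h] at this
      rw [← this]
      module)
  have r1 : (1 + κ) * (a + b + c - 1) = 0 := by linarith
  have r2 : (κ' - 1) * (a + b + c - 1) = 0 := by linarith
  by_contra hne
  have hne' : a + b + c - 1 ≠ 0 := fun h => hne (by linarith)
  have s1 : 1 + κ = 0 := by simpa [hne'] using r1
  have s2 : κ' - 1 = 0 := by simpa [hne'] using r2
  rw [hκ] at s1
  rw [hκ'] at s2
  field_simp at s1 s2
  simp only [map_sub, lie_comm z x, lie_comm z w] at s1 s2
  apply hxz
  linarith

/-- On the faces of Königs dual lifts, homogeneous coordinate vectors lie in an affine plane. -/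
theorem affine_of_koenigsDual {x y z w x' y' z' w' : R42} {a b c : ℝ} (hx : lie x x = 0)
    (hy : lie y y = 0) (hz : lie z z = 0) (hxy : lie x y ≠ 0)
    (hyz : lie y z ≠ 0) (hxz : lie x z ≠ 0) (hxw : lie x w ≠ 0) (hwz : lie w z ≠ 0)
    (h : w = a • x + b • y + c • z) (exy : Parallel (x - y) (x' - y'))
    (eyz : Parallel (y - z) (y' - z')) (ezw : Parallel (z - w) (z' - w'))
    (ewx : Parallel (w - x) (w' - x')) (d : Parallel (x - z) (y' - w'))
    (hyw' : y' - w' ≠ 0) : a + b + c = 1 := by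
  obtain ⟨l1, h1⟩ := eq_smul_of_parallel (sub_ne_zero_of_lie hx hxy) exy
  obtain ⟨l2, h2⟩ := eq_smul_of_parallel (sub_ne_zero_of_lie hy hyz) eyz
  obtain ⟨l3, h3⟩ := eq_smul_of_parallel
    (sub_ne_zero_of_lie hz (by rwa [lie_comm])) ezw
  obtain ⟨l4, h4⟩ := eq_smul_of_parallel (x := w - x) (by
    rw [← neg_sub]; exact neg_ne_zero.mpr (sub_ne_zero_of_lie hx hxw)) ewx
  obtain ⟨m, hm⟩ := eq_smul_of_parallel (sub_ne_zero_of_lie hx hxz) d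
  obtain ⟨p1, p2, p3⟩ := coeff_eq_zero_of_null hx hy hz hxy hyz hxz
    (α := l1 - l4 + (l4 - l3) * a) (β := l2 - l1 + (l4 - l3) * b)
    (γ := l3 - l2 + (l4 - l3) * c) (by
      have : l1 • (x - y) + l2 • (y - z) + l3 • (z - w) + l4 • (w - x) = 0 := by
        rw [← h1, ← h2, ← h3, ← h4]
        module
      rw [h] at this
      rw [← this]
      module)
  by_cases hl : l4 = l3
  · -- Then the dual face is homothetic and the diagonals supply the relation.
    subst hl
    obtain ⟨q1, q2, q3⟩ := coeff_eq_zero_of_null hx hy hz hxy hyz hxz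
      (α := m + l4 * a) (β := l4 * b - l4) (γ := l4 * c - m) (by
        have : m • (x - z) = l4 • (y - w) := by
          rw [← hm]
          have e : y' - w' = (y' - z') + (z' - w') := by module
          have hl2 : l2 = l4 := by linarith
          rw [e, h2, h3, hl2]
          module
        rw [h] at this
        rw [← sub_eq_zero] at this
        rw [← this]
        module)
    have hl4 : l4 ≠ 0 := by
      rintro rfl
      apply hyw'
      have : m = 0 := by linarith
      rw [hm, this, zero_smul]
    apply mul_left_cancel₀ hl4
    linarith
  · apply mul_left_cancel₀ (sub_ne_zero.mpr hl)
    linarith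

/-! ### Normalized lifts of a pair of maps into a sphere -/

/-- Lifts of two maps into the points of the sphere `q`, nowhere in contact, with inner products
normalized to `-1/2`. -/
structure IsNormalizedPair (p q : R42) (X Y : V → R42) : Prop where
  left_null : ∀ i, lie (X i) (X i) = 0
  right_null : ∀ i, lie (Y i) (Y i) = 0
  lie_eq : ∀ i, lie (X i) (Y i) = -1 / 2
  left_p : ∀ i, lie p (X i) = 0
  right_p : ∀ i, lie p (Y i) = 0
  left_q : ∀ i, lie q (X i) = 0
  right_q : ∀ i, lie q (Y i) = 0

namespace IsNormalizedPair

variable {p q : R42} {X Y : V → R42}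

theorem symm (h : IsNormalizedPair p q X Y) : IsNormalizedPair p q Y X :=
  ⟨h.right_null, h.left_null, fun i => by rw [lie_comm, h.lie_eq], h.right_p, h.left_p, h.right_q,
    h.left_q⟩

theorem left_ne_zero (h : IsNormalizedPair p q X Y) (i : V) : X i ≠ 0 := by
  intro h0
  have := h.lie_eq i
  rw [h0] at this
  norm_num at this

/-- If the end points of an edge of one map are in contact with the opposite end points of the
other, then the two edges are interchanged. -/
theorem exists_swap (h : IsNormalizedPair p q X Y) (hp : lie p p = -1) {i j : V}
    (hij : lie (X i) (X j) ≠ 0) (h1 : lie (X i) (Y j) = 0) (h2 : lie (X j) (Y i) = 0) :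
    ∃ r : ℝ, Y i = r • X j ∧ Y j = r • X i := by
  have hp' : lie p p < 0 := by rw [hp]; norm_num
  obtain ⟨r, hr⟩ := eq_smul_of_parallel (h.left_ne_zero j) (parallel_of_null hp' (h.left_null j)
    (h.right_null i) h2 (h.left_p j) (h.right_p i))
  obtain ⟨r', hr'⟩ := eq_smul_of_parallel (h.left_ne_zero i) (parallel_of_null hp' (h.left_null i)
    (h.right_null j) h1 (h.left_p i) (h.right_p j))
  have e1 := h.lie_eq i
  have e2 := h.lie_eq j
  rw [hr, map_smul, smul_eq_mul] at e1
  rw [hr', map_smul, smul_eq_mul, lie_comm] at e2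
  have : r = r' := mul_right_cancel₀ hij (e1.trans e2.symm)
  exact ⟨r, hr, this ▸ hr'⟩

end IsNormalizedPair

theorem smul_sub_smul_ne_zero {x x' : R42} {μ μ' : ℝ} (hx : lie x x = 0) (hxx' : lie x x' ≠ 0)
    (hμ' : μ' ≠ 0) : μ • x - μ' • x' ≠ 0 := by
  intro h
  have := congrArg (lie x) h
  simp [hx, hxx', hμ'] at this

/-- Rescaling two edges preserves parallelity only if the scaling is constant along each edge, as
soon as `x, x', y'` are pairwise not in contact. -/
theorem scale_eq_of_parallel {x x' y y' : R42} {μ μ' ν ν' : ℝ} (hx : lie x x = 0)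
    (hx' : lie x' x' = 0) (hy' : lie y' y' = 0) (hxx' : lie x x' ≠ 0) (hyy' : lie y y' ≠ 0)
    (hx'y' : lie x' y' ≠ 0) (hxy' : lie x y' ≠ 0) (hμ' : μ' ≠ 0) (hν : ν ≠ 0)
    (h : Parallel (x - x') (y - y')) (h' : Parallel (μ • x - μ' • x') (ν • y - ν' • y')) :
    μ = μ' ∧ ν = ν' := by
  obtain ⟨m, hm⟩ := eq_smul_of_parallel (sub_ne_zero_of_lie hx hxx') h
  obtain ⟨n, hn⟩ := eq_smul_of_parallel (smul_sub_smul_ne_zero hx hxx' hμ') h'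
  have hy : y = y' + m • (x - x') := by rw [← hm]; module
  have hm0 : m ≠ 0 := by
    rintro rfl
    rw [hy, zero_smul, add_zero] at hyy'
    exact hyy' hy'
  obtain ⟨p1, p2, p3⟩ := coeff_eq_zero_of_null hx hx' hy' hxx' hx'y' hxy'
    (α := ν * m - n * μ) (β := n * μ' - ν * m) (γ := ν - ν') (by
      rw [hy, ← sub_eq_zero] at hn
      rw [← hn]
      module)
  refine ⟨?_, by linarith⟩
  have hn0 : n ≠ 0 := by
    rintro rfl
    have : ν * m = 0 := by linarith
    exact mul_ne_zero hν hm0 this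
  apply mul_left_cancel₀ hn0
  linarith

/-- The Königs condition for a face on which the two maps are interchanged along opposite edges. -/
theorem parallel_diagonals_of_swap {x₁ x₂ x₃ x₄ y₁ y₂ y₃ y₄ : R42} {r r' : ℝ}
    (h₁ : y₁ = r • x₂) (h₂ : y₂ = r • x₁) (h₃ : y₃ = r' • x₄) (h₄ : y₄ = r' • x₃)
    (hne : x₄ - x₁ ≠ 0) (hpar : Parallel (x₄ - x₁) (y₄ - y₁))
    (haff : ∀ α β γ δ : ℝ, α • x₁ + β • x₂ + γ • x₃ + δ • x₄ = 0 → α + β + γ + δ = 0) :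
    Parallel (x₁ - x₃) (y₂ - y₄) ∧ Parallel (x₂ - x₄) (y₁ - y₃) := by
  obtain ⟨m, hm⟩ := eq_smul_of_parallel hne hpar
  have := haff m (-r) r' (-m) (by
    rw [h₄, h₁, ← sub_eq_zero] at hm
    rw [← hm]
    module)
  obtain rfl : r' = r := by linarith
  refine ⟨?_, ?_⟩
  · rw [h₂, h₄, ← smul_sub]
    simpa using parallel_smul_smul (x₁ - x₃) 1 r'
  · rw [h₁, h₃, ← smul_sub]
    simpa using parallel_smul_smul (x₂ - x₄) 1 r'

theorem Parallel.of_smul {x y : R42} {s t : ℝ} (hs : s ≠ 0) (ht : t ≠ 0)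
    (h : Parallel (s • x) (t • y)) : Parallel x y := by
  have := h.smul s⁻¹ t⁻¹
  rwa [inv_smul_smul₀ hs, inv_smul_smul₀ ht] at this

theorem Parallel.neg {x y x' y' : R42} (h : Parallel (x - x') (y - y')) :
    Parallel (x' - x) (y' - y) := by
  simpa using h.smul (-1) (-1)

/-- A linear relation `w = a x + b y + c z` with `a + b + c = 1` makes all relations affine. -/
theorem affine_relations {x y z w : R42} {a b c : ℝ} (hx : lie x x = 0)
    (hy : lie y y = 0) (hz : lie z z = 0) (hxy : lie x y ≠ 0)
    (hyz : lie y z ≠ 0) (hxz : lie x z ≠ 0)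
    (h : w = a • x + b • y + c • z) (habc : a + b + c = 1) (α β γ δ : ℝ)
    (hrel : α • x + β • y + γ • z + δ • w = 0) : α + β + γ + δ = 0 := by
  obtain ⟨h1, h2, h3⟩ := coeff_eq_zero_of_null hx hy hz hxy hyz hxz
    (α := α + δ * a) (β := β + δ * b) (γ := γ + δ * c) (by
      rw [h] at hrel
      rw [← hrel]
      module)
  linear_combination h1 + h2 + h3 - δ * habc

namespace IsNormalizedPair

variable {p q : R42} {X Y : V → R42}

/-- Along an edge, either the two maps are interchanged or a rescaling that preserves parallelity
is constant. -/
theorem scale_eq_or_swap (h : IsNormalizedPair p q X Y) (hp : lie p p = -1) {i j : V}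
    {μ ν : V → ℝ} (hX : lie (X i) (X j) ≠ 0) (hY : lie (Y i) (Y j) ≠ 0) (hμ : ∀ i, μ i ≠ 0)
    (hν : ∀ i, ν i ≠ 0) (hpar : Parallel (X i - X j) (Y i - Y j))
    (hpar' : Parallel (μ i • X i - μ j • X j) (ν i • Y i - ν j • Y j)) :
    (μ i = μ j ∧ ν i = ν j) ∨ ∃ r : ℝ, Y i = r • X j ∧ Y j = r • X i := by
  have hne : ∀ i, lie (X i) (Y i) ≠ 0 := fun i => by rw [h.lie_eq]; norm_num
  by_cases h1 : lie (X i) (Y j) = 0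
  · by_cases h2 : lie (X j) (Y i) = 0
    · exact Or.inr (h.exists_swap hp hX h1 h2)
    · left
      obtain ⟨e1, e2⟩ := scale_eq_of_parallel (h.left_null j) (h.left_null i) (h.right_null i)
        (by rwa [lie_comm]) (by rwa [lie_comm]) (hne i) h2 (hμ i) (hν j) hpar.neg hpar'.neg
      exact ⟨e1.symm, e2.symm⟩
  · left
    exact scale_eq_of_parallel (h.left_null i) (h.left_null j) (h.right_null j) hX hY (hne j) h1
      (hμ j) (hν i) hpar hpar'

/-- Normalized lifts with parallel edges and affine faces satisfy the Königs condition on diagonals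
if some rescaling of them does: either this rescaling is constant on the face or the two maps are
interchanged along two opposite edges of the face. -/
theorem isKoenigsDual (h : IsNormalizedPair p q X Y) (hp : lie p p = -1) {a : V → V → ℝ}
    (hX : IsIsothermicLift X a) (hY : IsIsothermicLift Y a) {μ ν : V → ℝ} (hμ : ∀ i, μ i ≠ 0)
    (hν : ∀ i, ν i ≠ 0) (hK : IsKoenigsDual (fun i => μ i • X i) (fun i => ν i • Y i))
    (hpar : ∀ i j, (latticeGraph V).Adj i j → Parallel (X i - X j) (Y i - Y j))
    (haff : ∀ i j k l : V, IsFace i j k l →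
      ∃ α β γ : ℝ, X l = α • X i + β • X j + γ • X k ∧ α + β + γ = 1) :
    IsKoenigsDual X Y := by
  refine ⟨hpar, fun i j k l hf => ?_⟩
  obtain ⟨hij, hjk, hkl, hli⟩ := hf.adj
  obtain ⟨hik, hjl, -, -⟩ := hX.2 i j k l hf
  obtain ⟨d1, d2⟩ := hK.2 i j k l hf
  have hrel : ∀ α β γ δ : ℝ, α • X i + β • X j + γ • X k + δ • X l = 0 → α + β + γ + δ = 0 := by
    obtain ⟨a, b, c, hl, habc⟩ := haff i j k l hf
    exact affine_relations (h.left_null i) (h.left_null j) (h.left_null k) (hX.1 i j hij)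
      (hX.1 j k hjk) hik hl habc
  -- If the maps are interchanged along an edge, they are not interchanged along the next one.
  have hswap : ∀ i j k, lie (X i) (X k) ≠ 0 → (∃ r : ℝ, Y i = r • X j ∧ Y j = r • X i) →
      (∃ r : ℝ, Y j = r • X k ∧ Y k = r • X j) → False := by
    rintro i j k hik ⟨r, -, hr⟩ ⟨r', hr', -⟩
    have h1 : lie (X i) (Y j) = 0 := by rw [hr, map_smul, h.left_null, smul_zero]
    rw [hr', map_smul, smul_eq_mul] at h1
    rcases mul_eq_zero.mp h1 with h0 | h0
    · rw [h0, zero_smul] at hr'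
      exact h.symm.left_ne_zero j hr'
    · exact hik h0
  have hedge := fun i j (hij : (latticeGraph V).Adj i j) => h.scale_eq_or_swap hp (hX.1 i j hij)
    (hY.1 i j hij) hμ hν (hpar i j hij) (hK.1 i j hij)
  have hconst : μ i = μ j → μ j = μ k → μ k = μ l → ν i = ν j → ν j = ν k → ν k = ν l →
      Parallel (X i - X k) (Y j - Y l) ∧ Parallel (X j - X l) (Y i - Y k) := by
    intro m1 m2 m3 n1 n2 n3
    simp only [m1, m2, m3, n1, n2, n3, ← smul_sub] at d1 d2
    exact ⟨d1.of_smul (hμ l) (hν l), d2.of_smul (hμ l) (hν l)⟩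
  have hne : ∀ i j, (latticeGraph V).Adj i j → X i - X j ≠ 0 := fun i j hij =>
    sub_ne_zero_of_lie (h.left_null i) (hX.1 i j hij)
  rcases hedge i j hij with ⟨m1, n1⟩ | s1
  · rcases hedge k l hkl with ⟨m3, n3⟩ | s3
    · rcases hedge j k hjk with ⟨m2, n2⟩ | ⟨r, s2, s2'⟩
      · exact hconst m1 m2 m3 n1 n2 n3
      · rcases hedge l i hli with ⟨m4, n4⟩ | ⟨r', s4, s4'⟩
        · exact hconst m1 (m1.symm.trans (m4.symm.trans m3.symm)) m3 n1
            (n1.symm.trans (n4.symm.trans n3.symm)) n3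
        · obtain ⟨e1, e2⟩ := parallel_diagonals_of_swap s2 s2' s4 s4' (hne i j hij)
            (hpar i j hij) (fun α β γ δ hh => by
              have := hrel δ α β γ (by rw [← hh]; module)
              linarith)
          exact ⟨by simpa using e2.smul (-1) 1, by simpa using e1.smul 1 (-1)⟩
    · rcases hedge j k hjk with ⟨m2, n2⟩ | s2
      · rcases hedge l i hli with ⟨m4, n4⟩ | s4
        · exact hconst m1 m2 (m2.symm.trans (m1.symm.trans m4.symm)) n1 n2
            (n2.symm.trans (n1.symm.trans n4.symm))
        · exact (hswap k l i (by rwa [lie_comm]) s3 s4).elim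
      · exact (hswap j k l hjl s2 s3).elim
  · rcases hedge j k hjk with ⟨m2, n2⟩ | s2
    · rcases hedge l i hli with ⟨m4, n4⟩ | s4
      · rcases hedge k l hkl with ⟨m3, n3⟩ | ⟨r', s3, s3'⟩
        · exact hconst (m4.symm.trans (m3.symm.trans m2.symm)) m2 m3
            (n4.symm.trans (n3.symm.trans n2.symm)) n2 n3
        · obtain ⟨r, s1, s1'⟩ := s1
          exact parallel_diagonals_of_swap s1 s1' s3 s3' (hne l i hli) (hpar l i hli) hrel
      · exact (hswap l i j (by rwa [lie_comm]) s4 s1).elim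
    · exact (hswap i j k hik s1 s2).elim

end IsNormalizedPair

/-! ### Orthogonal circles -/

theorem orthCircle_eq {p q : R42} (hp : lie p p = -1) (hpq : lie p q = 0)
    (x y : Submodule ℝ R42) : orthCircle p x y (q - p) = x ⊔ y ⊔ Submodule.span ℝ {q} := by
  have : q - p + lie (q - p) p • p = q := by
    rw [map_sub, LinearMap.sub_apply, hp, lie_comm, hpq]
    module
  rw [orthCircle, this]

theorem mem_span_sup_span_sup_span {x y z v : R42} :
    v ∈ Submodule.span ℝ {x} ⊔ Submodule.span ℝ {y} ⊔ Submodule.span ℝ {z} ↔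
      ∃ a b c : ℝ, a • x + b • y + c • z = v := by
  rw [sup_assoc, ← Submodule.span_insert, ← Submodule.span_insert, Submodule.mem_span_triple]

theorem isCircle_of_null {p q x y : R42} (hq : lie q q = 1) (hpq : lie p q = 0)
    (hx : lie x x = 0) (hy : lie y y = 0) (hxy : lie x y ≠ 0) (hpx : lie p x = 0)
    (hpy : lie p y = 0) (hqx : lie q x = 0) (hqy : lie q y = 0) :
    IsCircle p (Submodule.span ℝ {x} ⊔ Submodule.span ℝ {y} ⊔ Submodule.span ℝ {q}) := by
  refine ⟨?_, x + (1 / (2 * lie x y)) • y, q, x - (1 / (2 * lie x y)) • y, ?_, hq, ?_, ?_, ?_, ?_,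
    ?_⟩
  · refine sup_le (sup_le ?_ ?_) ?_ <;> rw [Submodule.span_singleton_le_iff_mem]
    · exact hpx
    · exact hpy
    · exact hpq
  · simp only [map_add, map_smul, LinearMap.add_apply, LinearMap.smul_apply, smul_eq_mul, hx, hy,
      lie_comm y x]
    field_simp
    ring
  · simp only [map_sub, map_smul, LinearMap.sub_apply, LinearMap.smul_apply, smul_eq_mul, hx, hy,
      lie_comm y x]
    field_simp
    ring
  · rw [lie_comm]
    simp only [map_add, map_smul, smul_eq_mul, hqx, hqy, mul_zero, add_zero]
  · simp only [map_add, map_sub, map_smul, LinearMap.add_apply, LinearMap.smul_apply, smul_eq_mul,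
      hx, hy, lie_comm y x]
    ring
  · simp only [map_sub, map_smul, smul_eq_mul, hqx, hqy, mul_zero, sub_zero]
  · ext v
    rw [mem_span_sup_span_sup_span, Submodule.mem_span_triple]
    constructor
    · rintro ⟨a, b, c, rfl⟩
      refine ⟨a / 2 + b * lie x y, c, a / 2 - b * lie x y, ?_⟩
      match_scalars <;> field_simp <;> ring
    · rintro ⟨a, b, c, rfl⟩
      exact ⟨a + c, a * (1 / (2 * lie x y)) - c * (1 / (2 * lie x y)), b, by module⟩

/-! ### Connections of circle congruences -/

theorem Interchanges.apply_mem {a : V → V → R42} {u : V → Submodule ℝ R42} (h : Interchanges a u)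
    {i j : V} (hij : (latticeGraph V).Adj i j) {v : R42} (hv : v ∈ u j) :
    lieInversion (a i j) v ∈ u i := by
  rw [← h i j hij]
  exact Submodule.mem_map_of_mem hv

theorem map_span_lieInversion_sub {x x' : R42} (hx : lie x x = 0) (hx' : lie x' x' = 0)
    (hxx' : lie x x' ≠ 0) :
    (Submodule.span ℝ {x'}).map (lieInversion (x - x')) = Submodule.span ℝ {x} := by
  rw [Submodule.map_span, Set.image_singleton, lieInversion_sub_right hx hx' hxx']

/-- The differences of Königs dual lifts define a flat connection for the congruence of orthogonal
circles. -/
theorem exists_flatConnection {p q : R42} {s t : V → Submodule ℝ R42} {a : V → V → ℝ}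
    {x y : V → R42} (hx : IsLift s x) (hy : IsLift t y) (hX : IsIsothermicLift x a)
    (hY : IsIsothermicLift y a) (hK : IsKoenigsDual x y) (hpx : ∀ i, lie p (x i) = 0)
    (hqx : ∀ i, lie q (x i) = 0) :
    ∃ b : V → V → R42, IsFlatConnection p (fun i => s i ⊔ t i ⊔ Submodule.span ℝ {q}) b ∧
      Interchanges b s ∧ Interchanges b t := by
  have hs : Interchanges (fun i j => x i - x j) s := by
    intro i j hij
    rw [(hx i).2.2, (hx j).2.2]
    exact map_span_lieInversion_sub (hx i).2.1 (hx j).2.1 (hX.1 i j hij)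
  have ht : Interchanges (fun i j => x i - x j) t := by
    intro i j hij
    -- The parallel edges of both maps define the same inversion.
    have hinv : lieInversion (x i - x j) = lieInversion (y i - y j) := by
      obtain ⟨m, hm⟩ := eq_smul_of_parallel
        (sub_ne_zero_of_lie (hx i).2.1 (hX.1 i j hij)) (hK.1 i j hij)
      rw [hm, lieInversion_smul]
      rintro rfl
      exact sub_ne_zero_of_lie (hy i).2.1 (hY.1 i j hij) (by rw [hm, zero_smul])
    simp only [hinv]
    rw [(hy i).2.2, (hy j).2.2]
    exact map_span_lieInversion_sub (hy i).2.1 (hy j).2.1 (hY.1 i j hij)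
  refine ⟨fun i j => x i - x j, ⟨fun i j hij => ⟨?_, ?_, ?_⟩, fun i j hij => ?_,
    fun i j k l hf => ?_⟩, hs, ht⟩
  · rw [lie_sub_self (hx i).2.1 (hx j).2.1]
    simpa using hX.1 i j hij
  · rw [lie_comm, map_sub, hpx, hpx, sub_zero]
  · beta_reduce
    rw [← neg_sub, lieInversion_neg]
  · have hqq : lieInversion (x i - x j) q = q := by
      apply lieInversion_of_perp
      rw [map_sub, hqx, hqx, sub_zero]
    simp only [Submodule.map_sup]
    rw [hs i j hij, ht i j hij, Submodule.map_span, Set.image_singleton, hqq]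
  · obtain ⟨hij, hjk, hkl, hli⟩ := hf.adj
    obtain ⟨hik, hjl, ⟨α, β, γ, h⟩, -⟩ := hX.2 i j k l hf
    have hil := hX.1 i l hli.symm
    have hlk := hX.1 l k hkl.symm
    have hyjl : y j - y l ≠ 0 := sub_ne_zero_of_lie (hy j).2.1 (hY.2 i j k l hf).2.1
    exact lieInversion_comp_of_affine (hx i).2.1 (hx j).2.1 (hx k).2.1 (hx l).2.1 (hX.1 i j hij)
      (hX.1 j k hjk) hil hlk h
      (affine_of_koenigsDual (hx i).2.1 (hx j).2.1 (hx k).2.1 (hX.1 i j hij) (hX.1 j k hjk) hik hil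
        hlk h (hK.1 i j hij) (hK.1 j k hjk) (hK.1 k l hkl) (hK.1 l i hli) (hK.2 i j k l hf).1 hyjl)

/-- An inversion that maps two points and the orthogonal circle through them onto another such
configuration fixes the sphere `q`. -/
theorem lie_connection_eq_zero {q b x y x' y' : R42} (hb : lie b b ≠ 0)
    (hx : lie x x = 0) (hy : lie y y = 0) (hxy : lie x y ≠ 0) (hqx : lie q x = 0)
    (hqy : lie q y = 0) (hqx' : lie q x' = 0) (hqy' : lie q y' = 0) (hxx' : lie x x' ≠ 0)
    (hx'0 : x' ≠ 0) (hy'0 : y' ≠ 0)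
    (h1 : lieInversion b x' ∈ Submodule.span ℝ {x}) (h2 : lieInversion b y' ∈ Submodule.span ℝ {y})
    (h3 : lieInversion b q ∈
      Submodule.span ℝ {x} ⊔ Submodule.span ℝ {y} ⊔ Submodule.span ℝ {q}) : lie b q = 0 := by
  have hinj : ∀ v, lieInversion b v = 0 → v = 0 := by
    intro v hv
    rw [← lieInversion_lieInversion hb v, hv, map_zero]
  obtain ⟨m, hm⟩ := Submodule.mem_span_singleton.mp h1
  obtain ⟨n, hn⟩ := Submodule.mem_span_singleton.mp h2
  obtain ⟨α, β, δ, hqq⟩ := mem_span_sup_span_sup_span.mp h3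
  have hm0 : m ≠ 0 := by
    rintro rfl
    exact hx'0 (hinj _ (by rw [← hm, zero_smul]))
  have hn0 : n ≠ 0 := by
    rintro rfl
    exact hy'0 (hinj _ (by rw [← hn, zero_smul]))
  have e1 := lie_lieInversion hb q x'
  have e2 := lie_lieInversion hb q y'
  rw [← hqq, ← hm, hqx'] at e1
  rw [← hqq, ← hn, hqy'] at e2
  simp only [map_add, map_smul, LinearMap.add_apply, LinearMap.smul_apply, smul_eq_mul, hx, hy, hqx,
    hqy, lie_comm y x, mul_zero, add_zero, zero_add] at e1 e2
  have hβ : β = 0 := by simpa [hm0, hxy] using e1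
  have hα : α = 0 := by simpa [hn0, hxy] using e2
  rw [hα, hβ, zero_smul, zero_smul, zero_add, zero_add, lieInversion_apply] at hqq
  by_contra hbq
  -- Otherwise `b` is parallel to `q` and all points of the sphere `q` are fixed.
  have hbx : lie x' b = 0 := by
    have h := congrArg (lie x') hqq
    simp only [map_sub, map_smul, smul_eq_mul, lie_comm x' q, hqx', mul_zero, zero_sub] at h
    have hc : 2 * lie q b / lie b b ≠ 0 := by
      rw [lie_comm q b]
      exact div_ne_zero (mul_ne_zero two_ne_zero hbq) hb
    have h' := (neg_eq_zero.mp h.symm)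
    exact (mul_eq_zero.mp h').resolve_left hc
  rw [lieInversion_of_perp hbx] at hm
  rw [← hm, map_smul, hx, smul_zero] at hxx'
  exact hxx' rfl

namespace IsNormalizedPair

variable {p q : R42} {X Y : V → R42}

theorem affine_of_flat (h : IsNormalizedPair p q X Y) {a : V → V → ℝ}
    (hX : IsIsothermicLift X a) {b : V → V → R42}
    (hb : ∀ i j, (latticeGraph V).Adj i j → lieInversion (b i j) (X j) = X i)
    (hflat : ∀ i j k l : V, IsFace i j k l →
      lieInversion (b i j) ∘ₗ lieInversion (b j k) = lieInversion (b i l) ∘ₗ lieInversion (b l k))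
    (i j k l : V) (hf : IsFace i j k l) :
    ∃ α β γ : ℝ, X l = α • X i + β • X j + γ • X k ∧ α + β + γ = 1 := by
  obtain ⟨hij, hjk, hkl, hli⟩ := hf.adj
  obtain ⟨hik, -, ⟨α, β, γ, hrel⟩, -⟩ := hX.2 i j k l hf
  have hinv : ∀ i j, (latticeGraph V).Adj i j →
      lieInversion (b i j) = lieInversion (X i - X j) := fun i j hij =>
    lieInversion_eq_of_apply (h.left_null i) (hX.1 i j hij) (hb i j hij)
  have hfl := hflat i j k l hf
  rw [hinv i j hij, hinv j k hjk, hinv i l hli.symm, hinv l k hkl.symm] at hfl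
  exact ⟨α, β, γ, hrel, affine_of_lieInversion_comp (h.left_null i) (h.left_null j) (h.left_null k)
    (h.left_null l) (hX.1 i j hij) (hX.1 j k hjk) hik (hX.1 i l hli.symm) (hX.1 l k hkl.symm) hrel
    hfl⟩

end IsNormalizedPair

/-! ### Flat fronts from normalized pairs -/

/-- Shifting the points by a fixed null vector preserves linear relations on faces that are affine,
hence being isothermic. -/
theorem IsIsothermicLift.shift {x : V → R42} {a : V → V → ℝ} {l : R42} (h : IsIsothermicLift x a)
    (hl : lie l l = 0) (hlx : ∀ i, lie l (x i) = 0)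
    (haff : ∀ i j k m : V, IsFace i j k m →
      ∃ α β γ : ℝ, x m = α • x i + β • x j + γ • x k ∧ α + β + γ = 1) :
    IsIsothermicLift (fun i => (2 : ℝ) • x i - l) a := by
  refine h.transfer (fun _ => 2) (fun _ => two_ne_zero) (fun i j => ?_) (fun i j k m hf _ => ?_)
  · simp only [map_sub, map_smul, LinearMap.sub_apply, LinearMap.smul_apply, smul_eq_mul, hl, hlx,
      lie_comm (x i) l]
    ring
  · obtain ⟨α, β, γ, hm, hs⟩ := haff i j k m hf
    refine ⟨α, β, γ, ?_⟩
    obtain rfl : γ = 1 - α - β := by linarith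
    rw [hm]
    module

theorem isLift_shift {x : V → R42} {l r : R42} (hx : ∀ i, lie (x i) (x i) = 0) (hl : lie l l = 0)
    (hlx : ∀ i, lie l (x i) = 0) (hrl : lie r l ≠ 0) (hrx : ∀ i, lie r (x i) = 0) :
    IsLift (fun i => Submodule.span ℝ {(2 : ℝ) • x i - l}) (fun i => (2 : ℝ) • x i - l) := by
  refine fun i => ⟨fun h => ?_, ?_, rfl⟩
  · have := congrArg (lie r) h
    simp only [map_sub, map_smul, hrx, smul_zero, zero_sub, map_zero, neg_eq_zero] at this
    exact hrl this
  · simp only [map_sub, map_smul, LinearMap.sub_apply, LinearMap.smul_apply, smul_eq_mul, hl, hlx,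
      lie_comm (x i) l, hx]
    ring

theorem IsNormalizedPair.isFlatFront {p q : R42} (hp : lie p p = -1) (hq : lie q q = 1)
    (hpq : lie p q = 0) {X Y : V → R42} (h : IsNormalizedPair p q X Y) {a : V → V → ℝ}
    (ha : IsEdgeLabelling a) (hX : IsIsothermicLift X a) (hY : IsIsothermicLift Y a)
    (hK : IsKoenigsDual X Y)
    (haffX : ∀ i j k m : V, IsFace i j k m →
      ∃ α β γ : ℝ, X m = α • X i + β • X j + γ • X k ∧ α + β + γ = 1)
    (haffY : ∀ i j k m : V, IsFace i j k m →
      ∃ α β γ : ℝ, Y m = α • Y i + β • Y j + γ • Y k ∧ α + β + γ = 1)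
    {f : V → Submodule ℝ R42} (hleg : IsLegendre f) (hproj : HasProjection p q f)
    (hf : ∀ i, Submodule.span ℝ {(2 : ℝ) • X i - (q - p)} ⊔
      Submodule.span ℝ {(2 : ℝ) • Y i - (q + p)} = f i) : IsFlatFront p q f := by
  have hqp : lie q p = 0 := by rw [lie_comm, hpq]
  have hl₁ : lie (q - p) (q - p) = 0 := by
    simp only [map_sub, LinearMap.sub_apply, hp, hq, hpq, hqp]
    norm_num
  have hl₂ : lie (q + p) (q + p) = 0 := by
    simp only [map_add, LinearMap.add_apply, hp, hq, hpq, hqp]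
    norm_num
  have hlX : ∀ i, lie (q - p) (X i) = 0 := fun i => by
    rw [map_sub, LinearMap.sub_apply, h.left_p, h.left_q, sub_zero]
  have hlY : ∀ i, lie (q + p) (Y i) = 0 := fun i => by
    rw [map_add, LinearMap.add_apply, h.right_p, h.right_q, add_zero]
  have hs := isLift_shift (r := q) h.left_null hl₁ hlX
    (by rw [map_sub, hq, hqp]; norm_num) h.left_q
  have ht := isLift_shift (r := q) h.right_null hl₂ hlY
    (by rw [map_add, hq, hqp]; norm_num) h.right_q
  refine ⟨hleg, hproj, _, _, ⟨⟨a, ha, (isIsothermic_iff hs).mpr (hX.shift hl₁ hlX haffX),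
    (isIsothermic_iff ht).mpr (hY.shift hl₂ hlY haffY)⟩, _, _, hs, ht, ?_, ?_⟩,
    fun i => (hf i).symm, fun i => ?_, fun i => ?_⟩
  · intro i j hij
    rw [sub_sub_sub_cancel_right, sub_sub_sub_cancel_right, ← smul_sub, ← smul_sub]
    exact (hK.1 i j hij).smul 2 2
  · intro i j k l hface
    simp only [sub_sub_sub_cancel_right, ← smul_sub]
    exact ⟨(hK.2 i j k l hface).1.smul 2 2, (hK.2 i j k l hface).2.smul 2 2⟩
  · rw [Submodule.span_singleton_le_iff_mem, mem_perp, map_sub, map_smul, hlX, hl₁, smul_zero,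
      sub_zero]
  · rw [Submodule.span_singleton_le_iff_mem, mem_perp, map_sub, map_smul, hlY, hl₂, smul_zero,
      sub_zero]

/-! ### Orthogonal nets of the cyclic system -/

theorem forall_of_connected {W : Type*} {G : SimpleGraph W} (hG : G.Connected) {P : W → Prop}
    (h : ∀ i j, G.Adj i j → P j → P i) {i : W} (hi : P i) (j : W) : P j := by
  obtain ⟨w⟩ := hG.preconnected j i
  induction w with
  | nil => exact hi
  | cons hadj _ ih => exact h _ _ hadj (ih hi)

/-- A vector that is orthogonal to all spheres which intersect the circle through `x` and `y`
orthogonally lies in the span of `x`, `y`, `p` and `q`. -/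
theorem eq_combination_of_orthogonal {p q X Y t : R42} (hp : lie p p = -1) (hq : lie q q = 1)
    (hpq : lie p q = 0) (hX : lie X X = 0) (hY : lie Y Y = 0) (hXY : lie X Y = -1 / 2)
    (hpX : lie p X = 0) (hpY : lie p Y = 0) (hqX : lie q X = 0) (hqY : lie q Y = 0)
    (ht : ∀ c : R42, lie c X = 0 → lie c Y = 0 → lie c q = 0 → lie c c = 0 →
      lie t (c + lie c p • p) = 0) :
    t = (-2 * lie t Y) • X + (-2 * lie t X) • Y + lie t q • q - lie t p • p := by
  -- The component `v` of `t` in the (positive definite) complement is itself a test vector.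
  obtain ⟨v, hv⟩ : ∃ v, v =
      t - ((-2 * lie t Y) • X + (-2 * lie t X) • Y + lie t q • q - lie t p • p) := ⟨_, rfl⟩
  have hvX : lie v X = 0 := by
    rw [hv]
    simp only [map_add, map_sub, map_smul, LinearMap.add_apply, LinearMap.sub_apply,
      LinearMap.smul_apply, smul_eq_mul, hX, hXY, hpX, hqX, lie_comm Y X]
    ring
  have hvY : lie v Y = 0 := by
    rw [hv]
    simp only [map_add, map_sub, map_smul, LinearMap.add_apply, LinearMap.sub_apply,
      LinearMap.smul_apply, smul_eq_mul, hY, hXY, hpY, hqY]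
    ring
  have hvq : lie v q = 0 := by
    rw [hv]
    simp only [map_add, map_sub, map_smul, LinearMap.add_apply, LinearMap.sub_apply,
      LinearMap.smul_apply, smul_eq_mul, lie_comm X q, lie_comm Y q, hpq, hqX, hqY, hq]
    ring
  have hvp : lie v p = 0 := by
    rw [hv]
    simp only [map_add, map_sub, map_smul, LinearMap.add_apply, LinearMap.sub_apply,
      LinearMap.smul_apply, smul_eq_mul, lie_comm X p, lie_comm Y p, lie_comm q p, hpq, hpX, hpY,
      hp]
    ring
  have hn : lie (X + Y) (X + Y) = -1 := by
    simp only [map_add, LinearMap.add_apply, hX, hY, hXY, lie_comm Y X]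
    norm_num
  obtain ⟨h0, hzero⟩ := lie_self_of_perp_negative_plane (v := v) hp hn
    (by rw [map_add, hpX, hpY, add_zero]) (by rw [lie_comm, hvp])
    (by rw [lie_comm, map_add, hvX, hvY, add_zero])
  have hvv : lie t v = lie v v := by
    have h : lie v ((-2 * lie t Y) • X + (-2 * lie t X) • Y + lie t q • q - lie t p • p) = 0 := by
      simp only [map_add, map_sub, map_smul, smul_eq_mul, hvX, hvY, hvp, hvq]
      ring
    rw [lie_comm t v, ← sub_zero (lie v t), ← h, ← map_sub, ← hv]
  -- The null vector `v + |v| p` represents a sphere that contains the circle.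
  have hpv : lie p v = 0 := by rw [lie_comm, hvp]
  have htest := ht (v + √(lie v v) • p)
    (by simp only [map_add, map_smul, LinearMap.add_apply, LinearMap.smul_apply, hvX, hpX,
      smul_zero, add_zero])
    (by simp only [map_add, map_smul, LinearMap.add_apply, LinearMap.smul_apply, hvY, hpY,
      smul_zero, add_zero])
    (by simp only [map_add, map_smul, LinearMap.add_apply, LinearMap.smul_apply, hvq, hpq,
      smul_zero, add_zero])
    (by
      simp only [map_add, map_smul, LinearMap.add_apply, LinearMap.smul_apply, smul_eq_mul, hvp,
        hpv, hp]
      linear_combination -Real.mul_self_sqrt h0)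
  have hsimp : v + √(lie v v) • p + lie (v + √(lie v v) • p) p • p = v := by
    simp only [map_add, map_smul, LinearMap.add_apply, LinearMap.smul_apply, smul_eq_mul, hvp, hp]
    module
  rw [hsimp, hvv] at htest
  exact sub_eq_zero.mp (hv.symm.trans (hzero htest))

/-- The point sphere and the tangent plane of a contact element orthogonal to the circle through
two points of the sphere `q`, in terms of normalized homogeneous coordinates of these points. The
sign `ε` is the orientation. -/
theorem IsContactElement.exists_normal_form {p q x y F : R42} (hp : lie p p = -1)
    (hq : lie q q = 1) (hpq : lie p q = 0) (hx : lie x x = 0) (hy : lie y y = 0)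
    (hpx : lie p x = 0) (hpy : lie p y = 0) (hqx : lie q x = 0) (hqy : lie q y = 0)
    {Z : Submodule ℝ R42} (hZ : IsContactElement Z)
    (hpt : pointSphere p Z ≤
      Submodule.span ℝ {x} ⊔ Submodule.span ℝ {y} ⊔ Submodule.span ℝ {q})
    (horth : ∀ s ∈ Z, ∀ c : R42,
      (∀ v ∈ Submodule.span ℝ {x} ⊔ Submodule.span ℝ {y} ⊔ Submodule.span ℝ {q}, lie c v = 0) →
        lie c c = 0 → lie s (c + lie c p • p) = 0)
    (hF : F ∈ Z) (hpF : lie p F = 0) (hqF : lie q F = -1) :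
    ∃ X ∈ Submodule.span ℝ {x}, ∃ Y ∈ Submodule.span ℝ {y}, ∃ T ∈ Z, ∃ ε : ℝ,
      (ε = 1 ∨ ε = -1) ∧ lie X Y = -1 / 2 ∧ F = X + Y - q ∧ T = ε • (X - Y) + p := by
  obtain ⟨α, β, δ, hFeq⟩ := mem_span_sup_span_sup_span.mp (hpt ⟨hF, hpF⟩)
  have hδ : δ = -1 := by
    rw [← hFeq] at hqF
    simpa [hqx, hqy, hq] using hqF
  obtain ⟨X, hXdef⟩ : ∃ X, X = α • x := ⟨_, rfl⟩
  obtain ⟨Y, hYdef⟩ : ∃ Y, Y = β • y := ⟨_, rfl⟩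
  have hX : lie X X = 0 := by simp [hXdef, hx]
  have hY : lie Y Y = 0 := by simp [hYdef, hy]
  have hpX : lie p X = 0 := by simp [hXdef, hpx]
  have hpY : lie p Y = 0 := by simp [hYdef, hpy]
  have hqX : lie q X = 0 := by simp [hXdef, hqx]
  have hqY : lie q Y = 0 := by simp [hYdef, hqy]
  have hFXY : F = X + Y - q := by
    rw [← hFeq, hδ, hXdef, hYdef]
    module
  have hFF : lie F F = 0 := hZ.2 F hF F hF
  have hXY : lie X Y = -1 / 2 := by
    rw [hFXY] at hFF
    simp only [map_add, map_sub, LinearMap.add_apply, LinearMap.sub_apply, hX, hY, hqX, hqY, hq,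
      lie_comm X q, lie_comm Y q, lie_comm Y X] at hFF
    linarith
  have hF0 : F ≠ 0 := by
    rintro rfl
    simp at hqF
  -- A sphere of `Z` in the complex of `q`, normalized to be a tangent plane.
  obtain ⟨t, htZ, ht⟩ : ∃ t ∈ Z, t ∉ Submodule.span ℝ {F} := by
    by_contra! hcon
    have := Submodule.finrank_mono (s := Z) (t := Submodule.span ℝ {F}) hcon
    rw [hZ.1, finrank_span_singleton hF0] at this
    norm_num at this
  have ht₀Z : t + lie q t • F ∈ Z := Z.add_mem htZ (Z.smul_mem _ hF)
  have hqt₀ : lie q (t + lie q t • F) = 0 := by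
    rw [map_add, map_smul, hqF]
    simp
  have hpt₀ : lie p (t + lie q t • F) ≠ 0 := by
    intro h0
    obtain ⟨c, hc⟩ := eq_smul_of_parallel hF0 (parallel_of_null (by rw [hp]; norm_num) hFF
      (hZ.2 _ ht₀Z _ ht₀Z) (hZ.2 _ hF _ ht₀Z) hpF h0)
    apply ht
    refine Submodule.mem_span_singleton.mpr ⟨c - lie q t, ?_⟩
    rw [sub_smul, ← hc]
    module
  obtain ⟨T, hTdef⟩ : ∃ T, T = (-(lie p (t + lie q t • F))⁻¹) • (t + lie q t • F) := ⟨_, rfl⟩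
  have hTZ : T ∈ Z := hTdef ▸ Z.smul_mem _ ht₀Z
  have hqT : lie q T = 0 := by rw [hTdef, map_smul, hqt₀, smul_zero]
  have hpT : lie p T = -1 := by
    rw [hTdef, map_smul, smul_eq_mul, neg_mul, inv_mul_cancel₀ hpt₀]
  have hXmem : X ∈ Submodule.span ℝ {x} := Submodule.mem_span_singleton.mpr ⟨α, hXdef.symm⟩
  have hYmem : Y ∈ Submodule.span ℝ {y} := Submodule.mem_span_singleton.mpr ⟨β, hYdef.symm⟩
  have hα : α ≠ 0 := by
    rintro rfl
    rw [hXdef] at hXY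
    norm_num at hXY
  have hβ : β ≠ 0 := by
    rintro rfl
    rw [hYdef] at hXY
    norm_num at hXY
  have hTeq := eq_combination_of_orthogonal (t := T) hp hq hpq hX hY hXY hpX hpY hqX hqY (by
    intro c hcX hcY hcq hcc
    refine horth T hTZ c ?_ hcc
    intro v hv
    obtain ⟨a, b, d, rfl⟩ := mem_span_sup_span_sup_span.mp hv
    have hcx : lie c x = 0 := by simpa [hXdef, hα] using hcX
    have hcy : lie c y = 0 := by simpa [hYdef, hβ] using hcY
    simp [hcx, hcy, hcq])
  rw [lie_comm T q, lie_comm T p, hqT, hpT] at hTeq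
  set A := -2 * lie T Y
  set B := -2 * lie T X
  have hT : T = A • X + B • Y + p := by
    conv_lhs => rw [hTeq]
    module
  have h1 := hZ.2 T hTZ T hTZ
  have h2 := hZ.2 T hTZ F hF
  rw [hT] at h1 h2
  rw [hFXY] at h2
  simp only [map_add, map_sub, map_smul, LinearMap.add_apply, LinearMap.smul_apply, smul_eq_mul,
    hX, hY, hXY, hpX, hpY, hp, hpq, lie_comm X q, lie_comm Y q, lie_comm X p, lie_comm Y p, hqX,
    hqY, lie_comm Y X] at h1 h2
  have hB : B = -A := by linarith
  refine ⟨X, hXmem, Y, hYmem, T, hTZ, A, ?_, hXY, hFXY, ?_⟩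
  · rw [hB] at h1
    have : (A - 1) * (A + 1) = 0 := by linarith
    rcases mul_eq_zero.mp this with h | h
    · exact Or.inl (by linarith)
    · exact Or.inr (by linarith)
  · rw [hT, hB]
    module

/-- Homogeneous coordinates of a Darboux pair that are transported by a flat connection are Königs
dual with affine faces. -/
theorem IsNormalizedPair.isKoenigsDual_of_connection {p q : R42} {X Y : V → R42}
    (h : IsNormalizedPair p q X Y) (hp : lie p p = -1) {a : V → V → ℝ}
    (hX : IsIsothermicLift X a) (hY : IsIsothermicLift Y a) {μ ν : V → ℝ} (hμ : ∀ i, μ i ≠ 0)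
    (hν : ∀ i, ν i ≠ 0) (hK : IsKoenigsDual (fun i => μ i • X i) (fun i => ν i • Y i))
    {b : V → V → R42}
    (hbX : ∀ i j, (latticeGraph V).Adj i j → lieInversion (b i j) (X j) = X i)
    (hbY : ∀ i j, (latticeGraph V).Adj i j → lieInversion (b i j) (Y j) = Y i)
    (hflat : ∀ i j k l : V, IsFace i j k l →
      lieInversion (b i j) ∘ₗ lieInversion (b j k) = lieInversion (b i l) ∘ₗ lieInversion (b l k)) :
    IsKoenigsDual X Y := by
  refine h.isKoenigsDual hp hX hY hμ hν hK (fun i j hij => ?_) (h.affine_of_flat hX hbX hflat)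
  obtain ⟨s, hs⟩ := exists_smul_of_lieInversion (hbX i j hij)
  obtain ⟨t, ht⟩ := exists_smul_of_lieInversion (hbY i j hij)
  rw [hs, ht]
  exact parallel_smul_smul _ s t

theorem eq_of_add_eq_add {X Y X' Y' : R42} (hX : lie X X = 0) (hY : lie Y Y = 0)
    (hXY : lie X Y ≠ 0) (hX' : X' ∈ Submodule.span ℝ {X}) (hY' : Y' ∈ Submodule.span ℝ {Y})
    (h : X' + Y' = X + Y) : X' = X ∧ Y' = Y := by
  obtain ⟨m, rfl⟩ := Submodule.mem_span_singleton.mp hX'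
  obtain ⟨n, rfl⟩ := Submodule.mem_span_singleton.mp hY'
  have h1 := congrArg (lie X) h
  have h2 := congrArg (lie Y) h
  simp only [map_add, map_smul, smul_eq_mul, hX, hY, lie_comm Y X] at h1 h2
  have hn : n = 1 := mul_right_cancel₀ hXY (by linarith)
  have hm : m = 1 := mul_right_cancel₀ hXY (by linarith)
  rw [hm, hn, one_smul, one_smul]
  exact ⟨rfl, rfl⟩

theorem span_eq_of_mem {x X : R42} (hX : X ∈ Submodule.span ℝ {x}) (hX0 : X ≠ 0) :
    Submodule.span ℝ {x} = Submodule.span ℝ {X} := by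
  obtain ⟨c, rfl⟩ := Submodule.mem_span_singleton.mp hX
  refine (Submodule.span_singleton_smul_eq (isUnit_iff_ne_zero.mpr ?_) x).symm
  rintro rfl
  exact hX0 (zero_smul _ _)

theorem span_sup_span_eq {f : Submodule ℝ R42} {p q F T : R42} (hf : IsContactElement f)
    (hF : F ∈ f) (hFQ : F ∈ quadric p q) (hT : T ∈ f) (hTH : T ∈ hyperplanes p q) :
    Submodule.span ℝ {F + T} ⊔ Submodule.span ℝ {F - T} = f := by
  apply le_antisymm
  · refine sup_le ?_ ?_ <;> rw [Submodule.span_singleton_le_iff_mem]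
    · exact f.add_mem hF hT
    · exact f.sub_mem hF hT
  · intro v hv
    rw [mem_span_sup_span]
    refine ⟨(-lie q v - lie p v) / 2, (-lie q v + lie p v) / 2, ?_⟩
    conv_rhs => rw [hf.eq_combination hF hFQ hT hTH hv]
    module

/-- The orthogonal nets of the cyclic system of a non-isotropic Darboux pair are flat fronts. -/
theorem isFlatFront_of_isOrthogonalNet (hV : (latticeGraph V).Connected) {p q : R42}
    (hp : lie p p = -1) (hq : lie q q = 1) (hpq : lie p q = 0) {s t : V → Submodule ℝ R42}
    {e : V → V → ℝ} {x y : V → R42} (he : IsEdgeLabelling e) (hx : IsLift s x) (hy : IsLift t y)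
    (hxiso : IsIsothermic s e) (hyiso : IsIsothermic t e)
    (hK : IsKoenigsDual x y) (hxy : ∀ i, lie (x i) (y i) ≠ 0)
    (hpx : ∀ i, lie p (x i) = 0) (hpy : ∀ i, lie p (y i) = 0)
    (hqx : ∀ i, lie q (x i) = 0) (hqy : ∀ i, lie q (y i) = 0)
    {b : V → V → R42} (hb : IsFlatConnection p (fun i => s i ⊔ t i ⊔ Submodule.span ℝ {q}) b)
    (hbs : Interchanges b s) (hbt : Interchanges b t) {f : V → Submodule ℝ R42}
    (hf : IsOrthogonalNet p (fun i => s i ⊔ t i ⊔ Submodule.span ℝ {q}) f)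
    (hbf : Interchanges b f) (hne : ∃ i, ¬ pointSphere p (f i) ≤ perp q) : IsFlatFront p q f := by
  have hxe := (isIsothermic_iff hx).mp hxiso
  have hs : ∀ i, s i = Submodule.span ℝ {x i} := fun i => (hx i).2.2
  have ht : ∀ i, t i = Submodule.span ℝ {y i} := fun i => (hy i).2.2
  obtain ⟨hleg, hpt, horth⟩ := hf
  obtain ⟨hb0, hbγ, hflat⟩ := hb
  simp only [hs, ht] at hpt horth hbγ
  -- The connection fixes `p` and `q`.
  have hσp : ∀ i j, (latticeGraph V).Adj i j → lieInversion (b i j) p = p := fun i j hij =>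
    lieInversion_of_perp (by rw [lie_comm]; exact (hb0 i j hij).2.1)
  have hσq : ∀ i j, (latticeGraph V).Adj i j → lieInversion (b i j) q = q := by
    intro i j hij
    apply lieInversion_of_perp
    rw [lie_comm]
    refine lie_connection_eq_zero (hb0 i j hij).1 (hx i).2.1 (hy i).2.1 (hxy i) (hqx i) (hqy i)
      (hqx j) (hqy j) (hxe.1 i j hij) (hx j).1 (hy j).1 ?_ ?_ ?_
    · rw [← hs i]
      refine hbs.apply_mem hij ?_
      rw [hs j]
      exact Submodule.mem_span_singleton_self _
    · rw [← ht i]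
      refine hbt.apply_mem hij ?_
      rw [ht j]
      exact Submodule.mem_span_singleton_self _
    · refine hbγ.apply_mem hij ?_
      exact Submodule.mem_sup_right (Submodule.mem_span_singleton_self _)
  have hlieσ : ∀ i j, (latticeGraph V).Adj i j → ∀ v,
      lie p (lieInversion (b i j) v) = lie p v ∧ lie q (lieInversion (b i j) v) = lie q v := by
    intro i j hij v
    have h1 := lie_lieInversion (hb0 i j hij).1 p v
    have h2 := lie_lieInversion (hb0 i j hij).1 q v
    rw [hσp i j hij] at h1
    rw [hσq i j hij] at h2
    exact ⟨h1, h2⟩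
  -- Hence all point spheres can be normalized.
  have hFex : ∀ i, ∃ F ∈ f i, lie p F = 0 ∧ lie q F = -1 := by
    obtain ⟨i₀, hi₀⟩ := hne
    obtain ⟨v, ⟨hvf, hpv⟩, hqv⟩ := SetLike.not_le_iff_exists.mp hi₀
    rw [mem_perp] at hqv
    refine forall_of_connected hV (fun i j hij => ?_) (i := i₀) ?_
    · rintro ⟨F, hF, hpF, hqF⟩
      obtain ⟨h1, h2⟩ := hlieσ i j hij F
      exact ⟨_, hbf.apply_mem hij hF, h1.trans hpF, h2.trans hqF⟩
    · rw [SetLike.mem_coe, mem_perp] at hpv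
      refine ⟨(-(lie q v)⁻¹) • v, (f i₀).smul_mem _ hvf, ?_, ?_⟩
      · rw [map_smul, hpv, smul_zero]
      · rw [map_smul, smul_eq_mul, neg_mul, inv_mul_cancel₀ hqv]
  choose F hFf hpF hqF using hFex
  have hnf := fun i => (hleg.1 i).exists_normal_form hp hq hpq (hx i).2.1 (hy i).2.1 (hpx i)
    (hpy i) (hqx i) (hqy i) (hpt i) (horth i) (hFf i) (hpF i) (hqF i)
  choose X hXx Y hYy T hTf ε hε hXY hFXY hTXY using hnf
  have hnorm : IsNormalizedPair p q X Y := by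
    choose α hα using fun i => Submodule.mem_span_singleton.mp (hXx i)
    choose β hβ using fun i => Submodule.mem_span_singleton.mp (hYy i)
    refine ⟨fun i => ?_, fun i => ?_, hXY, fun i => ?_, fun i => ?_, fun i => ?_, fun i => ?_⟩
    · simp [← hα, (hx i).2.1]
    · simp [← hβ, (hy i).2.1]
    · simp [← hα, hpx]
    · simp [← hβ, hpy]
    · simp [← hα, hqx]
    · simp [← hβ, hqy]
  have hXlift : IsLift s X := fun i => ⟨hnorm.left_ne_zero i, hnorm.left_null i,
    (hs i).trans (span_eq_of_mem (hXx i) (hnorm.left_ne_zero i))⟩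
  have hYlift : IsLift t Y := fun i => ⟨hnorm.symm.left_ne_zero i, hnorm.right_null i,
    (ht i).trans (span_eq_of_mem (hYy i) (hnorm.symm.left_ne_zero i))⟩
  have hXe := (isIsothermic_iff hXlift).mp hxiso
  have hYe := (isIsothermic_iff hYlift).mp hyiso
  have hXY0 : ∀ i, lie (X i) (Y i) ≠ 0 := fun i => by rw [hXY]; norm_num
  have hFQ : ∀ i, F i ∈ quadric p q := fun i =>
    ⟨(hleg.1 i).2 _ (hFf i) _ (hFf i), by rw [lie_comm, hqF], by rw [lie_comm, hpF]⟩
  have hTH : ∀ i, T i ∈ hyperplanes p q := by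
    refine fun i => ⟨(hleg.1 i).2 _ (hTf i) _ (hTf i), ?_, ?_⟩
    · rw [lie_comm, hTXY, map_add, map_smul, map_sub, hnorm.left_q, hnorm.right_q, lie_comm q p,
        hpq]
      simp
    · rw [lie_comm, hTXY, map_add, map_smul, map_sub, hnorm.left_p, hnorm.right_p, hp]
      simp
  have hproj : HasProjection p q f := ⟨F, T, fun i => ⟨hFf i, hFQ i, hTf i, hTH i⟩⟩
  -- The connection transports all of these coordinates.
  have hσF : ∀ i j, (latticeGraph V).Adj i j → lieInversion (b i j) (F j) = F i := by
    intro i j hij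
    obtain ⟨h1, h2⟩ := hlieσ i j hij (F j)
    rw [(hleg.1 i).eq_combination (hFf i) (hFQ i) (hTf i) (hTH i)
      (hbf.apply_mem hij (hFf j)), h1, h2, hpF, hqF]
    simp
  have hσT : ∀ i j, (latticeGraph V).Adj i j → lieInversion (b i j) (T j) = T i := by
    intro i j hij
    obtain ⟨h1, h2⟩ := hlieσ i j hij (T j)
    rw [(hleg.1 i).eq_combination (hFf i) (hFQ i) (hTf i) (hTH i)
      (hbf.apply_mem hij (hTf j)), h1, h2, lie_comm p, lie_comm q, (hTH j).2.1, (hTH j).2.2]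
    simp
  have hσXY : ∀ i j, (latticeGraph V).Adj i j →
      lieInversion (b i j) (X j) = X i ∧ lieInversion (b i j) (Y j) = Y i := by
    intro i j hij
    refine eq_of_add_eq_add (hnorm.left_null i) (hnorm.right_null i) (hXY0 i) ?_ ?_ ?_
    · rw [← (hXlift i).2.2]
      refine hbs.apply_mem hij ?_
      rw [(hXlift j).2.2]
      exact Submodule.mem_span_singleton_self _
    · rw [← (hYlift i).2.2]
      refine hbt.apply_mem hij ?_
      rw [(hYlift j).2.2]
      exact Submodule.mem_span_singleton_self _
    · have h := hσF i j hij
      rw [hFXY i, hFXY j, map_sub, hσq i j hij, sub_left_inj, map_add] at h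
      exact h
  have hεij : ∀ i j, (latticeGraph V).Adj i j → ε i = ε j := by
    intro i j hij
    have h := hσT i j hij
    rw [hTXY i, hTXY j, map_add, hσp i j hij, map_smul, map_sub, (hσXY i j hij).1,
      (hσXY i j hij).2, add_left_inj] at h
    have h' := congrArg (lie (X i)) h
    simp only [map_smul, map_sub, hnorm.left_null, hXY, smul_eq_mul] at h'
    linarith
  obtain ⟨μ, hμ⟩ := hXlift.exists_smul hx
  obtain ⟨ν, hν⟩ := hYlift.exists_smul hy
  have hKμ : IsKoenigsDual (fun i => μ i • X i) (fun i => ν i • Y i) := by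
    have h1 : x = fun i => μ i • X i := funext fun i => (hμ i).2
    have h2 : y = fun i => ν i • Y i := funext fun i => (hν i).2
    rw [← h1, ← h2]
    exact hK
  have hbX := fun i j hij => (hσXY i j hij).1
  have hbY := fun i j hij => (hσXY i j hij).2
  have hKXY := hnorm.isKoenigsDual_of_connection hp hXe hYe (fun i => (hμ i).1)
    (fun i => (hν i).1) hKμ hbX hbY hflat
  have haffX := hnorm.affine_of_flat hXe hbX hflat
  have haffY := hnorm.symm.affine_of_flat hYe hbY hflat
  have hfspan := fun i => span_sup_span_eq (hleg.1 i) (hFf i) (hFQ i) (hTf i) (hTH i)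
  obtain ⟨i₀⟩ := hV.nonempty
  -- The orientation decides which of the two maps is the Gauss map on which side.
  rcases hε i₀ with h1 | h1
  · have hε1 : ∀ i, ε i = 1 :=
      forall_of_connected hV (fun i j hij hj => (hεij i j hij).trans hj) h1
    refine hnorm.isFlatFront hp hq hpq he hXe hYe hKXY haffX haffY hleg hproj fun i => ?_
    rw [← hfspan i, hFXY i, hTXY i, hε1 i]
    congr 3 <;> module
  · have hε1 : ∀ i, ε i = -1 :=
      forall_of_connected hV (fun i j hij hj => (hεij i j hij).trans hj) h1
    have hKYX : IsKoenigsDual Y X := ⟨fun i j hij => (hKXY.1 i j hij).symm, fun i j k l hface =>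
      ⟨(hKXY.2 i j k l hface).2.symm, (hKXY.2 i j k l hface).1.symm⟩⟩
    refine hnorm.symm.isFlatFront hp hq hpq he hYe hXe hKYX haffY haffX hleg hproj fun i => ?_
    rw [← hfspan i, hFXY i, hTXY i, hε1 i]
    congr 3 <;> module

end LieGeom

theorem mainTheorem4 (V : Set (ℤ × ℤ)) (hV : (LieGeom.latticeGraph V).Connected)
    (p q : LieGeom.R42) (hp : LieGeom.lie p p = -1) (hq : LieGeom.lie q q = 1)
    (hpq : LieGeom.lie p q = 0) :
    -- the hyperbolic Gauss maps of a flat front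
    (∀ f : V → Submodule ℝ LieGeom.R42, LieGeom.IsFlatFront p q f →
      ∀ hplus hminus : V → Submodule ℝ LieGeom.R42,
        hplus = LieGeom.gaussMap p (q - p) f → hminus = LieGeom.gaussMap p (q + p) f →
        LieGeom.IsDarbouxPair hplus hminus ∧
        LieGeom.NonIsotropic hplus hminus ∧
        (∀ i, hplus i ≤ LieGeom.perp p ⊓ LieGeom.perp q) ∧
        (∀ i, hminus i ≤ LieGeom.perp p ⊓ LieGeom.perp q) ∧
        LieGeom.IsTotallyUmbilic (fun i => hplus i ⊔ Submodule.span ℝ {q - p}) ∧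
        LieGeom.IsTotallyUmbilic (fun i => hminus i ⊔ Submodule.span ℝ {q + p})) ∧
    -- the cyclic circle congruence associated to a Darboux pair on the sphere of `q`
    (∀ hplus hminus : V → Submodule ℝ LieGeom.R42,
      LieGeom.IsDarbouxPair hplus hminus → LieGeom.NonIsotropic hplus hminus →
      (∀ i, hplus i ≤ LieGeom.perp p ⊓ LieGeom.perp q) →
      (∀ i, hminus i ≤ LieGeom.perp p ⊓ LieGeom.perp q) →
      ∀ γ : V → Submodule ℝ LieGeom.R42,
        (∀ i, γ i = LieGeom.orthCircle p (hplus i) (hminus i) (q - p)) →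
        (∀ i, LieGeom.IsCircle p (γ i)) ∧
        (∃ a : V → V → LieGeom.R42, LieGeom.IsFlatConnection p γ a ∧
          LieGeom.Interchanges a hplus ∧ LieGeom.Interchanges a hminus) ∧
        ∀ a : V → V → LieGeom.R42, LieGeom.IsFlatConnection p γ a →
          LieGeom.Interchanges a hplus → LieGeom.Interchanges a hminus →
          ∀ f : V → Submodule ℝ LieGeom.R42, LieGeom.IsOrthogonalNet p γ f →
            LieGeom.Interchanges a f →
            (∃ i, ¬ LieGeom.pointSphere p (f i) ≤ LieGeom.perp q) →
            LieGeom.IsFlatFront p q f) := by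
  refine ⟨?_, ?_⟩
  · rintro f hf _ _ rfl rfl
    exact hf.gaussMaps hp hq hpq
  · rintro s t ⟨⟨e, he, hs, ht⟩, x, y, hx, hy, hK⟩ hiso hsW htW γ hγ
    obtain rfl : γ = fun i => s i ⊔ t i ⊔ Submodule.span ℝ {q} :=
      funext fun i => (hγ i).trans (LieGeom.orthCircle_eq hp hpq _ _)
    have hxW : ∀ i, LieGeom.lie p (x i) = 0 ∧ LieGeom.lie q (x i) = 0 := fun i =>
      hsW i (by rw [(hx i).2.2]; exact Submodule.mem_span_singleton_self _)
    have hyW : ∀ i, LieGeom.lie p (y i) = 0 ∧ LieGeom.lie q (y i) = 0 := fun i =>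
      htW i (by rw [(hy i).2.2]; exact Submodule.mem_span_singleton_self _)
    have hxy : ∀ i, LieGeom.lie (x i) (y i) ≠ 0 := by
      intro i h0
      obtain ⟨u, hu, v, hv, huv⟩ := hiso i
      rw [(hx i).2.2] at hu
      rw [(hy i).2.2] at hv
      obtain ⟨c, rfl⟩ := Submodule.mem_span_singleton.mp hu
      obtain ⟨d, rfl⟩ := Submodule.mem_span_singleton.mp hv
      simp [h0] at huv
    refine ⟨fun i => ?_, ?_, fun b hb hbs hbt f hf hbf hne => ?_⟩
    · beta_reduce
      rw [(hx i).2.2, (hy i).2.2]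
      exact LieGeom.isCircle_of_null hq hpq (hx i).2.1 (hy i).2.1 (hxy i) (hxW i).1 (hyW i).1
        (hxW i).2 (hyW i).2
    · exact LieGeom.exists_flatConnection hx hy ((LieGeom.isIsothermic_iff hx).mp hs)
        ((LieGeom.isIsothermic_iff hy).mp ht) hK (fun i => (hxW i).1) (fun i => (hxW i).2)
    · exact LieGeom.isFlatFront_of_isOrthogonalNet hV hp hq hpq he hx hy hs ht hK hxy
        (fun i => (hxW i).1) (fun i => (hyW i).1) (fun i => (hxW i).2) (fun i => (hyW i).2)
        hb hbs hbt hf hbf hne
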